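/- Let ${\bf k}$ be an algebraically closed field and let $A=\bigoplus_{m\ge 0}A_m$ be a commutative graded ${\bf k}$-algebra with finite-dimensional graded pieces. Let $N$ be a lattice and $\Sigma$ a smooth fan in $N_{\mathbb Q}$ with rays $\varrho_1,\dots,\varrho_n$ and primitive ray generators $\rho_1,\dots,\rho_n$. Let $\mathcal{O}_\Sigma$ be the semifield (under pointwise $\min$ and $+$) consisting of the constant $\infty$ and of the functions $|\Sigma|\cap N\to\mathbb Z$ that are linear on each cone of some finite subdivision of $|\Sigma|$ into rational cones. Let $\mathfrak v:A\to\mathcal O_\Sigma$ be a valuation (i.e. $\mathfrak v(fg)=\mathfrak v(f)+\mathfrak v(g)$, $\mathfrak v(f+g)\ge\min\{\mathfrak v(f),\mathfrak v(g)\}$, $\mathfrak v(c)=0$ for $c\in{\bf k}\setminus\{0\}$, $\mathfrak v(0)=\infty$) which corresponds to a positively graded flat toric sheaf of algebras on the toric variety $Y(\Sigma)$; that is: (i) $\mathfrak v$ is homogeneous: $\mathfrak v(\sum_m f_m)=\min_{f_m\ne0}\mathfrak v(f_m)$ for $f_m\in A_m$; (ii) for each $\sigma\in\Sigma$ there is a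 vector space basis $\mathbb B_\sigma$ of $A$ such that each $\mathfrak v(b)|_\sigma$, $b\in\mathbb B_\sigma$, is an integral linear function and $\mathfrak v(\sum c_b b)|_\sigma=\min_{c_b\neq0}\mathfrak v(b)|_\sigma$. Let $\mathcal B=\{b_1,\dots,b_d\}\subset A$ be a set of nonzero homogeneous elements which generates $A$ and is a Khovanskii basis of $\mathfrak v$: for each $\rho\in|\Sigma|\cap N$ the classes of the $b_j$ generate the associated graded algebra of $f\mapsto\mathfrak v(f)(\rho)$. For an integral function $\psi$ on $|\Sigma|\cap N$ that is linear on each cone of $\Sigma$ put $F_\psi=\{f\in A\mid\mathfrak v(f)\ge\psi\}$. Let $\mathcal R(A,\hat{\mathfrak v})=\bigoplus_\psi F_\psi$ be the total section ring, an algebra over the Cox ring $S_\Sigma={\bf k}[X_1,\dots,X_n]$ of $Y(\Sigma)$ (the ring spanned by the elements $1\in F_\varphi$, $\varphi\le0$, each of which acts by the inclusions $F_\psi\subseteq F_{\psi+\varphi}$). The set $\mathcal B$ is a *strong Khovanskii basis* if it is the image of a set of homogeneous $S_\Sigma$-algebra generators of $\mathcal R(A,\hat{\mathfrak v})$ under the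 natural map $\mathcal R(A,\hat{\mathfrak v})\to A$ given by the inclusions $F_\psi\subseteq A$. Let $I_{\mathcal B}\subset{\bf k}[y_1,\dots,y_d]$ be the kernel of $y_j\mapsto b_j$. Let $\Psi(\rho_i)=(\mathfrak v(b_1)(\rho_i),\dots,\mathfrak v(b_d)(\rho_i))$, the $i$-th row of the diagram. Let $\mathcal I_{\mathcal B}$ (also written $I^{\rm Rees}_{\mathcal B}$) be the kernel of $${\bf k}[Y_1,\dots,Y_d,X_1,\dots,X_n]\to A\otimes_{\bf k}{\bf k}[t_1^{\pm},\dots,t_n^{\pm}],\qquad X_i\mapsto t_i^{-1},\quad Y_j\mapsto b_j\prod_i t_i^{\mathfrak v(b_j)(\rho_i)} .$$ Initial forms collect the terms of minimal weight. The tropical variety $\operatorname{Trop}(J)$ of an ideal $J$ is the set of rational weights for which the minimal weight of the terms of each nonzero element of $J$ is attained at least twice. Two points of $\operatorname{Trop}(\mathcal I_{\mathcal B})$ lie in the same (relatively open) face if and only if they have the same initial ideal. Let $\pi:\operatorname{Trop}(\mathcal I_{\mathcal B})\to\operatorname{Trop}(I_{\mathcal B})$ be the map $\pi(w,m)=(w_j+\sum_i\mathfrak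 v(b_j)(\rho_i)\,m_i)_j$, and let $s(w)=(w,0)$. The faces of $\operatorname{Trop}(I_{\mathcal B})$ are the images under $\pi$ of the faces of $\operatorname{Trop}(\mathcal I_{\mathcal B})$, and the lift of a face $C$ is $\tilde C=\pi^{-1}(C)$. A face whose initial ideal is prime is called a prime cone, and a point of the tropical variety whose initial ideal is prime is called a prime point. Then for each $i$ there is exactly one face $C_i$ of $\operatorname{Trop}(I_{\mathcal B})$ that contains $\Psi(\rho_i)$. The initial ideal of $I_{\mathcal B}$ is the same at all points of $C_i$, and it is prime. Moreover, the following are equivalent: (a) $\mathcal B$ is a strong Khovanskii basis; (b) for each $i=1,\dots,n$ the lift $\tilde C_i$ is a prime cone of $\operatorname{Trop}(\mathcal I_{\mathcal B})$; (c) for each $i=1,\dots,n$ the point $s(\Psi(\rho_i))$ is a prime point of $\operatorname{Trop}(\mathcal I_{\mathcal B})$. -/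

import Mathlib

open scoped DirectSum

noncomputable section

/-! ### Fans -/

/-- `τ` is the face of `σ` cut out by a linear form that is nonnegative on `σ`. -/
def IsConeFace {N : Type*} [AddCommGroup N] (τ σ : AddSubmonoid N) : Prop :=
  ∃ m : N →+ ℤ, (∀ x ∈ σ, 0 ≤ m x) ∧ ∀ x, x ∈ τ ↔ x ∈ σ ∧ m x = 0

/-- Rational polyhedral cones of `N ⊗ ℚ`, each given by its monoid of lattice points in `N`:
these monoids are exactly the finitely generated saturated ones. -/
def IsRationalCone {N : Type*} [AddCommGroup N] (σ : AddSubmonoid N) : Prop :=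
  σ.FG ∧ ∀ (q : ℕ) (x : N), 0 < q → q • x ∈ σ → x ∈ σ

/-- A (finite) rational fan in the lattice `N`; a cone is given by its lattice points. -/
structure RationalFan (N : Type*) [AddCommGroup N] where
  cones : Set (AddSubmonoid N)
  finite_cones : cones.Finite
  rational : ∀ σ ∈ cones, IsRationalCone σ
  strongly_convex : ∀ σ ∈ cones, ∀ x, x ∈ σ → -x ∈ σ → x = 0
  face_mem : ∀ σ ∈ cones, ∀ τ, IsConeFace τ σ → τ ∈ cones
  inter_face : ∀ σ ∈ cones, ∀ τ ∈ cones, IsConeFace (σ ⊓ τ) σ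

namespace RationalFan

variable {N : Type*} [AddCommGroup N] (S : RationalFan N)

/-- The lattice points `|Σ| ∩ N` of the support. -/
def support : Set N := {x | ∃ σ ∈ S.cones, x ∈ σ}

/-- The set of primitive generators of the rays of the fan (the cone `ℕ ρ` is
saturated, so `ρ` is primitive). It is in bijection with `Σ(1)`. -/
def rays : Set N := {ρ | ρ ≠ 0 ∧ AddSubmonoid.multiples ρ ∈ S.cones}

/-- The primitive generator of a ray as a point of the support. -/
def rayPoint (ρ : S.rays) : S.support :=
  ⟨ρ.1, _, ρ.2.2, AddSubmonoid.mem_multiples ρ.1⟩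

/-- Every cone is generated by a part of a basis of the lattice. -/
def IsSmooth : Prop :=
  ∀ σ ∈ S.cones, ∃ (e : Module.Basis (Fin (Module.finrank ℤ N)) ℤ N)
    (T : Set (Fin (Module.finrank ℤ N))), σ = AddSubmonoid.closure (e '' T)

/-- The semifield `𝒪_Σ`: the integral functions on `|Σ| ∩ N` which are linear on each cone of
some finite subdivision of `|Σ|` into rational cones, and the function `∞`. -/
def piecewiseLinear : Set (S.support → WithTop ℤ) :=
  {φ | φ = ⊤ ∨ ∃ T : Set (AddSubmonoid N), T.Finite ∧ (∀ τ ∈ T, IsRationalCone τ) ∧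
    (∀ x, x ∈ S.support ↔ ∃ τ ∈ T, x ∈ τ) ∧
    ∀ τ ∈ T, ∃ m : N →+ ℤ, ∀ x : S.support, x.1 ∈ τ → φ x = (m x.1 : ℤ)}

/-- The functions `ψ : |Σ| ∩ N → ℤ` that are linear on each cone of `Σ`, that is, the
torus-linearized line bundles on the toric variety of `Σ`. -/
def divisors : AddSubgroup (S.support → ℤ) where
  carrier := {ψ | ∀ σ ∈ S.cones, ∃ m : N →+ ℤ, ∀ x : S.support, x.1 ∈ σ → ψ x = m x.1}
  zero_mem' := fun _ _ => ⟨0, fun _ _ => rfl⟩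
  add_mem' := by
    intro a b ha hb σ hσ
    obtain ⟨m, hm⟩ := ha σ hσ
    obtain ⟨m', hm'⟩ := hb σ hσ
    exact ⟨m + m', fun x hx => by simp [hm x hx, hm' x hx]⟩
  neg_mem' := by
    intro a ha σ hσ
    obtain ⟨m, hm⟩ := ha σ hσ
    exact ⟨-m, fun x hx => by simp [hm x hx]⟩

end RationalFan

/-! ### Quasivaluations -/

/-- A quasivaluation on the `k`-algebra `A` with values in functions `X → ℤ ∪ {∞}`; the sum of
the target semialgebra is the pointwise minimum, its product the pointwise sum. -/
structure Quasivaluation (k A X : Type*) [Field k] [CommRing A] [Algebra k A] where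
  toFun : A → X → WithTop ℤ
  le_map_mul : ∀ f g x, toFun f x + toFun g x ≤ toFun (f * g) x
  le_map_add : ∀ f g x, min (toFun f x) (toFun g x) ≤ toFun (f + g) x
  map_const : ∀ c : k, c ≠ 0 → ∀ x, toFun (algebraMap k A c) x = 0
  map_zero : ∀ x, toFun 0 x = ⊤

namespace Quasivaluation

variable {k A X : Type*} [Field k] [CommRing A] [Algebra k A] (v : Quasivaluation k A X)

instance : CoeFun (Quasivaluation k A X) (fun _ => A → X → WithTop ℤ) := ⟨toFun⟩

/-- A valuation is a quasivaluation that is multiplicative. -/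
def IsValuation : Prop := ∀ f g x, v (f * g) x = v f x + v g x

theorem map_one_eq (x : X) : v 1 x = 0 := by
  simpa using v.map_const 1 one_ne_zero x

theorem le_map_smul (c : k) (f : A) (x : X) : v f x ≤ v (c • f) x := by
  rcases eq_or_ne c 0 with rfl | hc
  · simp [v.map_zero]
  · have h := v.le_map_mul (algebraMap k A c) f x
    rwa [v.map_const c hc, zero_add, ← Algebra.smul_def] at h

/-- The space `{f | v f ≥ ψ}` of elements whose value is at least `ψ`. -/
def levelSpace (ψ : X → ℤ) : Submodule k A where
  carrier := {f | ∀ x, ((ψ x : ℤ) : WithTop ℤ) ≤ v f x}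
  zero_mem' := fun x => by simp [v.map_zero]
  add_mem' := fun ha hb x => (le_min (ha x) (hb x)).trans (v.le_map_add _ _ x)
  smul_mem' := fun c f hf x => (hf x).trans (v.le_map_smul c f x)

/-- The filtration `G_r = {f | v f x ≥ r}` of the quasivaluation `f ↦ v f x`. -/
def filtration (x : X) (r : ℤ) : Submodule k A where
  carrier := {f | (r : WithTop ℤ) ≤ v f x}
  zero_mem' := by simp [v.map_zero]
  add_mem' := fun ha hb => (le_min ha hb).trans (v.le_map_add _ _ x)
  smul_mem' := fun c f hf => le_trans hf (v.le_map_smul c f x)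

instance filtration_gradedMonoid (x : X) : SetLike.GradedMonoid (v.filtration x) where
  one_mem := by
    change ((0 : ℤ) : WithTop ℤ) ≤ v 1 x
    rw [v.map_one_eq]; exact le_rfl
  mul_mem := by
    intro i j f g hf hg
    change ((i + j : ℤ) : WithTop ℤ) ≤ v (f * g) x
    rw [WithTop.coe_add]
    exact (add_le_add hf hg).trans (v.le_map_mul f g x)

/-- The algebra `⨁ G_r`. -/
def ReesAlgebra (x : X) : Type _ := ⨁ r, v.filtration x r

instance (x : X) : CommRing (v.ReesAlgebra x) :=
  inferInstanceAs (CommRing (⨁ r, v.filtration x r))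

instance (x : X) : Algebra k (v.ReesAlgebra x) :=
  inferInstanceAs (Algebra k (⨁ r, v.filtration x r))

/-- The element `a` of the summand `G_r` of `⨁ G_r`. -/
def reesOf (x : X) (r : ℤ) (a : v.filtration x r) : v.ReesAlgebra x :=
  DirectSum.of (fun r => v.filtration x r) r a

/-- The ideal `⨁ G_{>r}` of `⨁ G_r`. -/
def gradedIdeal (x : X) : Ideal (v.ReesAlgebra x) :=
  Ideal.span {y | ∃ (r : ℤ) (a : v.filtration x r), (r : WithTop ℤ) < v a.1 x ∧
    y = v.reesOf x r a}

/-- The associated graded algebra `⨁ G_r / G_{>r}` of the quasivaluation `f ↦ v f x`. -/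
abbrev associatedGraded (x : X) : Type _ := v.ReesAlgebra x ⧸ v.gradedIdeal x

/-- `B` is a Khovanskii basis of `f ↦ v f x`: the classes in degree `v b x` of the
`b ∈ B` with `v b x ≠ ∞` generate the associated graded algebra. -/
def IsKhovanskiiBasisAt (B : Set A) (x : X) : Prop :=
  Algebra.adjoin k {y : v.associatedGraded x | ∃ (r : ℤ) (a : v.filtration x r),
    a.1 ∈ B ∧ v a.1 x = r ∧ y = Ideal.Quotient.mk _ (v.reesOf x r a)} = ⊤

/-- A generating set of `A` which is a Khovanskii basis at every point. -/
def IsKhovanskiiBasis (B : Set A) : Prop :=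
  Algebra.adjoin k B = ⊤ ∧ ∀ x, v.IsKhovanskiiBasisAt B x

open Classical in
/-- Homogeneity for a grading: `(A, v)` is the direct sum of the `(A_m, v|A_m)`. -/
def IsHomogeneous (𝒜 : ℕ → Submodule k A) [GradedAlgebra 𝒜] : Prop :=
  ∀ f x, v f x =
    (DirectSum.decompose 𝒜 f).support.inf fun m => v ((DirectSum.decompose 𝒜 f) m : A) x

/-- The value of `f` at `x` as an integer (`0` if it is infinite). -/
def intValue (f : A) (x : X) : ℤ := (v f x).untopD 0

end Quasivaluation

section Fiberwise

variable {k A N : Type*} [Field k] [CommRing A] [Algebra k A] [AddCommGroup N]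
  {S : RationalFan N} (v : Quasivaluation k A S.support)

/-- The restriction of `v` to the cone `σ` has a linear adapted basis: a basis of `A` such that
`v (∑ c_b b) = min {v b | c_b ≠ 0}` on `σ`, and such that each `v b` is linear on `σ`. -/
def HasLinearAdaptedBasis (σ : AddSubmonoid N) : Prop :=
  ∃ (𝔹 : Set A) (e : Module.Basis 𝔹 k A), (∀ b, e b = b.1) ∧
    (∀ (f : A) (x : S.support), x.1 ∈ σ → v f x = (e.repr f).support.inf fun b => v b.1 x) ∧
    ∀ b : 𝔹, ∃ m : N →+ ℤ, ∀ x : S.support, x.1 ∈ σ → v b.1 x = (m x.1 : ℤ)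

/-- The Klyachko spaces `F_ψ = {f | v f ≥ ψ}` for the line bundles `ψ`. -/
def sectionSpace (ψ : S.divisors) : Submodule k A := v.levelSpace ψ.1

instance sectionSpace_gradedMonoid : SetLike.GradedMonoid (sectionSpace v) where
  one_mem := by
    intro x
    change ((0 : ℤ) : WithTop ℤ) ≤ v 1 x
    rw [v.map_one_eq]; exact le_rfl
  mul_mem := by
    intro i j f g hf hg x
    change ((i.1 x + j.1 x : ℤ) : WithTop ℤ) ≤ v (f * g) x
    rw [WithTop.coe_add]
    exact (add_le_add (hf x) (hg x)).trans (v.le_map_mul f g x)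

/-- The total section ring `⨁_ψ F_ψ` over all line bundles `ψ`. -/
abbrev TotalSectionRing : Type _ := ⨁ ψ : S.divisors, sectionSpace v ψ

open Classical in
/-- The natural quotient map from the total section ring to `A`, which is the inclusion
`F_ψ ⊆ A` on each summand. -/
def totalSectionMap : TotalSectionRing v →ₐ[k] A := DirectSum.coeAlgHom (sectionSpace v)

open Classical in
/-- The monomials `1 ∈ F_φ`, `φ ≤ 0`. They span the Cox ring `k[X_ϱ : ϱ ∈ Σ(1)]` of the toric
variety as a subring of the total section ring; multiplying by one of them is an inclusion
`F_ψ ⊆ F_{ψ+φ}`. -/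
def coxMonomials : Set (TotalSectionRing v) :=
  {y | ∃ (φ : S.divisors) (h : (1 : A) ∈ sectionSpace v φ),
    y = DirectSum.of (fun ψ => sectionSpace v ψ) φ ⟨1, h⟩}

open Classical in
/-- `B` is the image in `A` of a set of homogeneous generators of the total section ring, as an
algebra over the Cox ring. -/
def IsStrongKhovanskiiBasis (B : Set A) : Prop :=
  ∃ G : Set (TotalSectionRing v),
    (∀ g ∈ G, ∃ (ψ : S.divisors) (a : sectionSpace v ψ),
      g = DirectSum.of (fun ψ => sectionSpace v ψ) ψ a) ∧
    Algebra.adjoin k (coxMonomials v ∪ G) = ⊤ ∧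
    totalSectionMap v '' G = B

end Fiberwise

/-! ### Initial ideals and tropical varieties -/

section Tropical

variable {k τ : Type*} [Field k]

open Classical in
/-- The initial form of `p`: the sum of the terms of minimal `w`-weight. -/
def initialForm (w : τ → ℚ) (p : MvPolynomial τ k) : MvPolynomial τ k :=
  ∑ m ∈ p.support with ∀ m' ∈ p.support, Finsupp.weight w m ≤ Finsupp.weight w m',
    MvPolynomial.monomial m (p.coeff m)

/-- The initial ideal of `J`, generated by the initial forms of the elements of `J`. -/
def initialIdeal (w : τ → ℚ) (J : Ideal (MvPolynomial τ k)) : Ideal (MvPolynomial τ k) :=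
  Ideal.span (initialForm w '' (J : Set (MvPolynomial τ k)))

/-- The tropical variety: leaving out any one term of an element of `J` does not change the
minimal weight of its terms. -/
def tropicalVariety (J : Ideal (MvPolynomial τ k)) : Set (τ → ℚ) :=
  {w | ∀ p ∈ J, ∀ m ∈ p.support, ∃ m' ∈ p.support, m' ≠ m ∧
    Finsupp.weight w m' ≤ Finsupp.weight w m}

/-- The (relatively open) faces of `Trop(J)` for the fan structure induced from the Gröbner fan:
two points of `Trop(J)` lie in the same face if and only if they have the same initial ideal. -/
def groebnerFaces (J : Ideal (MvPolynomial τ k)) : Set (Set (τ → ℚ)) :=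
  {C | ∃ w ∈ tropicalVariety J,
    C = {w' | w' ∈ tropicalVariety J ∧ initialIdeal w' J = initialIdeal w J}}

/-- A prime cone is a face whose initial ideal is prime. -/
def IsPrimeCone (J : Ideal (MvPolynomial τ k)) (C : Set (τ → ℚ)) : Prop :=
  C ∈ groebnerFaces J ∧ ∀ w ∈ C, (initialIdeal w J).IsPrime

/-- A prime point is a point of the tropical variety whose initial ideal is prime. -/
def IsPrimePoint (J : Ideal (MvPolynomial τ k)) (w : τ → ℚ) : Prop :=
  w ∈ tropicalVariety J ∧ (initialIdeal w J).IsPrime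

end Tropical

/-! ### The two presentation ideals and the lift -/

section Lift

variable {k A N : Type*} [Field k] [CommRing A] [Algebra k A] [AddCommGroup N]
  {S : RationalFan N} (v : Quasivaluation k A S.support) {n d : ℕ} (ρ : Fin n ≃ S.rays)
  (b : Fin d → A)

/-- The `(i, j)` entry `v(b_j)(ρ_i)` of the diagram. -/
def diagram (i : Fin n) (j : Fin d) : ℤ := v.intValue (b j) (S.rayPoint (ρ i))

/-- The point `Ψ(ρ_i)`, that is, the `i`-th row of the diagram. -/
def diagramRow (i : Fin n) : Fin d → ℚ := fun j => diagram v ρ b i j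

/-- `I_B`, the kernel of `k[y_1, …, y_d] → A`, `y_j ↦ b_j`. -/
def presentationIdeal (k : Type*) [Field k] [Algebra k A] (b : Fin d → A) :
    Ideal (MvPolynomial (Fin d) k) :=
  RingHom.ker (MvPolynomial.aeval b : MvPolynomial (Fin d) k →ₐ[k] A)

/-- The map `k[Y_1, …, Y_d, X_1, …, X_n] → A[t_1^±, …, t_n^±]` with
`Y_j ↦ b_j t^{(v(b_j)(ρ_1), …, v(b_j)(ρ_n))}` and `X_i ↦ t_i⁻¹`. -/
def reesPresentation :
    MvPolynomial (Fin d ⊕ Fin n) k →ₐ[k] AddMonoidAlgebra A (Fin n → ℤ) :=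
  MvPolynomial.aeval (Sum.elim
    (fun j => AddMonoidAlgebra.single (fun i => diagram v ρ b i j) (b j))
    (fun i => AddMonoidAlgebra.single (-Pi.single i 1) 1))

/-- The kernel of the map `reesPresentation`. -/
def reesIdeal : Ideal (MvPolynomial (Fin d ⊕ Fin n) k) := RingHom.ker (reesPresentation v ρ b)

/-- The projection `π(w, m) = (w_j + ∑ i, v(b_j)(ρ_i) m_i)_j`. -/
def tropProj (u : Fin d ⊕ Fin n → ℚ) : Fin d → ℚ :=
  fun j => u (Sum.inl j) + ∑ i, (diagram v ρ b i j : ℚ) * u (Sum.inr i)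

/-- The section `s(w) = (w, 0)` of the projection. -/
def tropSection (n : ℕ) {d : ℕ} (w : Fin d → ℚ) : Fin d ⊕ Fin n → ℚ := Sum.elim w 0

/-- The faces of `Trop(I_B)` for the fan structure induced from `Trop` of the larger ideal along
the projection `π`. -/
def inducedFaces : Set (Set (Fin d → ℚ)) :=
  {C | ∃ D ∈ groebnerFaces (reesIdeal v ρ b), C = tropProj v ρ b '' D}

/-- The lift of a face: its preimage in `Trop` of the larger ideal. -/
def liftFace (C : Set (Fin d → ℚ)) : Set (Fin d ⊕ Fin n → ℚ) :=
  {u | u ∈ tropicalVariety (reesIdeal v ρ b) ∧ tropProj v ρ b u ∈ C}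

end Lift

end

/-! ### Initial ideals -/

section InitialIdeal

open MvPolynomial

/-! Write `V_i` for the valuation at `ρ_i`, `D` for the diagram, `I` for `I_B` and `J` for the
kernel of the Rees presentation. `J` is homogeneous for the `ℤ^n`-grading in which `Y_j` has degree
the `j`-th column of `D` and `X_i` has degree `-e_i`. In a fixed multidegree the exponents of the
`Y_j` determine those of the `X_i`, so `X = 1` is injective there, and `J` is the
multihomogenization of `I`. Hence `Trop(J) = π⁻¹(Trop(I))`, the initial ideals of `J` depend only on
`π(u)`, and `X = 1` carries `in_{s(w)} J` onto `in_w I` (`map_dehomogenize_initialIdeal`). This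
gives the statements about faces and the equivalence of (b) and (c).

Subduction shows that a polynomial of `D_i`-weight `z` lies in the initial ideal of `I` at `Ψ(ρ_i)`
exactly when its value under `V_i` exceeds `z`. Multiplicativity of `V_i` makes that ideal prime.

On a smooth fan line bundles correspond to integer vectors of ray values, and by flatness sections
are tested on rays. So the total section ring is `⨁_r {f | V_i f ≥ r_i for all i} t^r`, and (a) says
that the Rees presentation maps onto it (`IsReesSaturated`, `isStrongKhovanskiiBasis_iff`).

In multidegree `δ` the weight `s(Ψ(ρ_i))` is `δ_i` plus the exponent of `X_i`. If the presentation
is saturated, this shows that `in J` consists of everything whose multihomogeneous components land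
in `in I` under `X = 1`; it is then the kernel of a map to a Laurent polynomial ring over a domain
(`isPrime_initialIdeal_of_isReesSaturated`). Conversely, primeness permits cancelling monomials in
the `X_l`, and this makes a representative of `f t^r` divisible by `X_i` as soon as `V_i f > r_i`
(`single_add_mem_range_of_isPrime`). Raising the exponent one unit at a time reaches every allowed
`r`. -/

theorem MvPolynomial.sum_weightedHomogeneousComponent_image {R τ M : Type*} [CommSemiring R]
    [AddCommMonoid M] [DecidableEq M] (w : τ → M) (P : MvPolynomial τ R) :
    ∑ ω ∈ P.support.image (Finsupp.weight w), weightedHomogeneousComponent w ω P = P := by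
  ext m
  rw [coeff_sum]
  simp only [coeff_weightedHomogeneousComponent]
  rw [Finset.sum_ite_eq]
  split_ifs with h
  · rfl
  · by_contra h'
    exact h (Finset.mem_image_of_mem _ (mem_support_iff.2 (Ne.symm h')))

theorem MvPolynomial.mem_of_weightedHomogeneousComponent_mem {R τ M : Type*} [CommSemiring R]
    [AddCommMonoid M] (w : τ → M) {P : MvPolynomial τ R} {I : Ideal (MvPolynomial τ R)}
    (h : ∀ ω, weightedHomogeneousComponent w ω P ∈ I) : P ∈ I := by
  classical
  rw [← sum_weightedHomogeneousComponent_image w P]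
  exact I.sum_mem fun ω _ => h ω

variable {k τ : Type*} [Field k]

open Classical in
theorem coeff_initialForm (w : τ → ℚ) (p : MvPolynomial τ k) (m : τ →₀ ℕ) :
    (initialForm w p).coeff m =
      if ∀ m' ∈ p.support, Finsupp.weight w m ≤ Finsupp.weight w m' then p.coeff m else 0 := by
  rw [initialForm, coeff_sum]
  simp only [coeff_monomial]
  rw [Finset.sum_ite_eq']
  simp only [Finset.mem_filter]
  by_cases hm : m ∈ p.support
  · simp only [hm, true_and]
  · simp [notMem_support_iff.1 hm]

/-- When there are no terms of smaller weight, the component is either zero or the initial form of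
`Q`. -/
theorem weightedHomogeneousComponent_mem_initialIdeal (w : τ → ℚ)
    {J : Ideal (MvPolynomial τ k)} {Q : MvPolynomial τ k} (hQ : Q ∈ J) {ω : ℚ}
    (h : ∀ m, Finsupp.weight w m < ω → Q.coeff m = 0) :
    weightedHomogeneousComponent w ω Q ∈ initialIdeal w J := by
  classical
  by_cases h0 : weightedHomogeneousComponent w ω Q = 0
  · rw [h0]; exact Ideal.zero_mem _
  obtain ⟨m₀, hm₀⟩ := ne_zero_iff.1 h0
  rw [coeff_weightedHomogeneousComponent] at hm₀
  have hw₀ : Finsupp.weight w m₀ = ω := by by_contra hne; simp [hne] at hm₀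
  rw [if_pos hw₀] at hm₀
  refine Ideal.subset_span ⟨Q, hQ, ?_⟩
  ext m
  rw [coeff_initialForm, coeff_weightedHomogeneousComponent]
  by_cases hm : Finsupp.weight w m = ω
  · rw [if_pos hm, if_pos]
    intro m' hm'
    rw [hm]
    by_contra hlt
    exact mem_support_iff.1 hm' (h m' (not_le.1 hlt))
  · rw [if_neg hm]
    split_ifs with hmin
    · refine h m (lt_of_le_of_ne ?_ hm)
      rw [← hw₀]
      exact hmin m₀ (mem_support_iff.2 hm₀)
    · rfl

/-- A polynomial lies in the initial ideal if and only if each of its weighted homogeneous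
components is the lowest part of an element of the ideal. -/
theorem mem_initialIdeal_iff {w : τ → ℚ} {J : Ideal (MvPolynomial τ k)} {P : MvPolynomial τ k} :
    P ∈ initialIdeal w J ↔ ∀ ω : ℚ, ∃ Q ∈ J, ∀ m,
      (Finsupp.weight w m < ω → Q.coeff m = 0) ∧
      (Finsupp.weight w m = ω → Q.coeff m = P.coeff m) := by
  classical
  constructor
  · intro hP
    refine Submodule.span_induction (p := fun P _ => ∀ ω : ℚ, ∃ Q ∈ J, ∀ m,
      (Finsupp.weight w m < ω → Q.coeff m = 0) ∧
      (Finsupp.weight w m = ω → Q.coeff m = P.coeff m)) ?_ ?_ ?_ ?_ hP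
    · rintro _ ⟨p, hp, rfl⟩ ω
      by_cases h : ∀ m' ∈ p.support, ω ≤ Finsupp.weight w m'
      · refine ⟨p, hp, fun m => ⟨fun hm => ?_, fun hm => ?_⟩⟩
        · by_contra hc
          exact absurd (h m (mem_support_iff.2 hc)) (not_le.2 hm)
        · rw [coeff_initialForm, if_pos]
          rwa [hm]
      · refine ⟨0, J.zero_mem, fun m => ⟨fun hm => coeff_zero _, fun hm => ?_⟩⟩
        rw [coeff_initialForm, if_neg, coeff_zero]
        rwa [hm]
    · exact fun ω => ⟨0, J.zero_mem, fun m => by simp⟩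
    · intro x y _ _ hx hy ω
      obtain ⟨Q, hQ, h⟩ := hx ω
      obtain ⟨Q', hQ', h'⟩ := hy ω
      refine ⟨Q + Q', J.add_mem hQ hQ', fun m => ⟨fun hm => ?_, fun hm => ?_⟩⟩
      · simp [(h m).1 hm, (h' m).1 hm]
      · simp [(h m).2 hm, (h' m).2 hm]
    · intro a x _ hx
      rw [smul_eq_mul]
      induction a using MvPolynomial.induction_on' with
      | monomial u c =>
        intro ω
        -- Multiplication by the monomial shifts every weight by that of `u`.
        obtain ⟨Q, hQ, h⟩ := hx (ω - Finsupp.weight w u)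
        refine ⟨monomial u c * Q, J.mul_mem_left _ hQ, fun m => ?_⟩
        simp only [coeff_monomial_mul']
        by_cases hu : u ≤ m
        · have hw : Finsupp.weight w (m - u) = Finsupp.weight w m - Finsupp.weight w u := by
            rw [eq_sub_iff_add_eq, ← map_add, tsub_add_cancel_of_le hu]
          simp only [hu, if_true]
          refine ⟨fun hm => ?_, fun hm => ?_⟩
          · rw [(h _).1 (by rw [hw]; linarith), mul_zero]
          · rw [(h _).2 (by rw [hw]; linarith)]
        · simp [hu]
      | add p q hp hq =>
        intro ω
        obtain ⟨Q, hQ, h⟩ := hp ω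
        obtain ⟨Q', hQ', h'⟩ := hq ω
        refine ⟨Q + Q', J.add_mem hQ hQ', fun m => ⟨fun hm => ?_, fun hm => ?_⟩⟩
        · simp [(h m).1 hm, (h' m).1 hm]
        · simp [(h m).2 hm, (h' m).2 hm, add_mul]
  · intro h
    refine mem_of_weightedHomogeneousComponent_mem w fun ω => ?_
    obtain ⟨Q, hQ, hm⟩ := h ω
    convert weightedHomogeneousComponent_mem_initialIdeal w hQ (fun m => (hm m).1) using 1
    ext m
    rw [coeff_weightedHomogeneousComponent, coeff_weightedHomogeneousComponent]
    split_ifs with hω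
    · exact ((hm m).2 hω).symm
    · rfl

theorem weight_intCast (e : τ → ℤ) (m : τ →₀ ℕ) :
    Finsupp.weight (fun j => (e j : ℚ)) m = ((Finsupp.weight e m : ℤ) : ℚ) := by
  simp [Finsupp.weight_apply, Finsupp.sum]

end InitialIdeal

/-! ### Presentations of valued algebras -/

section Valued

open MvPolynomial

variable {k A τ : Type*} [Field k] [CommRing A] [Algebra k A] (W : AddValuation A (WithTop ℤ))
  (b : τ → A) (e : τ → ℤ)

/-- Every element of `A` is a polynomial in the `b j` all of whose terms have at least the value
of the element. -/
def HasSubduction (k : Type*) [Field k] [Algebra k A] (W : AddValuation A (WithTop ℤ))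
    (b : τ → A) (e : τ → ℤ) : Prop :=
  ∀ f : A, ∃ p : MvPolynomial τ k, aeval b p = f ∧
    ∀ m ∈ p.support, W f ≤ (Finsupp.weight e m : ℤ)

variable {W b e} (hW : ∀ c : k, c ≠ 0 → W (algebraMap k A c) = 0) (he : ∀ j, W (b j) = e j)

include hW he in
theorem map_aeval_monomial {c : k} (hc : c ≠ 0) (m : τ →₀ ℕ) :
    W (aeval b (monomial m c)) = (Finsupp.weight e m : ℤ) := by
  rw [aeval_monomial, AddValuation.map_mul, hW c hc, zero_add]
  induction m using Finsupp.induction with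
  | zero => simp
  | single_add j q m hj hq ih =>
    classical
    rw [Finsupp.prod_add_index' (by simp) (fun _ _ _ => pow_add _ _ _), AddValuation.map_mul, ih,
      Finsupp.prod_single_index (by simp), AddValuation.map_pow, he, map_add,
      Finsupp.weight_single, WithTop.coe_add]
    congr 1

include hW he in
theorem le_map_aeval {p : MvPolynomial τ k} {g : WithTop ℤ}
    (h : ∀ m ∈ p.support, g ≤ (Finsupp.weight e m : ℤ)) : g ≤ W (aeval b p) := by
  rw [p.as_sum, map_sum]
  refine AddValuation.map_le_sum W fun m hm => ?_
  rw [map_aeval_monomial hW he (mem_support_iff.1 hm)]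
  exact h m hm

include hW he in
-- A unique term of least weight in a relation would equal minus the sum of the others, whose value
-- is larger by at least one because values of monomials are integers.
theorem mem_tropicalVariety_ker_aeval :
    (fun j => (e j : ℚ)) ∈
      tropicalVariety (RingHom.ker (aeval b : MvPolynomial τ k →ₐ[k] A)) := by
  classical
  intro p hp m hm
  by_contra! hcon
  have hc := mem_support_iff.1 hm
  have h1 : aeval b (p - monomial m (p.coeff m)) = - aeval b (monomial m (p.coeff m)) := by
    rw [map_sub, (RingHom.mem_ker.1 hp : aeval b p = 0), zero_sub]
  have h2 : ((Finsupp.weight e m + 1 : ℤ) : WithTop ℤ) ≤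
      W (aeval b (p - monomial m (p.coeff m))) := by
    refine le_map_aeval hW he fun m' hm' => ?_
    have hne : m' ≠ m := by
      rintro rfl
      simp at hm'
    have hs : m' ∈ p.support := by
      rw [mem_support_iff, coeff_sub, coeff_monomial, if_neg (Ne.symm hne), sub_zero] at hm'
      exact mem_support_iff.2 hm'
    have := hcon m' hs hne
    rw [weight_intCast, weight_intCast] at this
    have h3 : Finsupp.weight e m < Finsupp.weight e m' := by exact_mod_cast this
    exact_mod_cast h3
  rw [h1, AddValuation.map_neg, map_aeval_monomial hW he hc] at h2
  have : Finsupp.weight e m + 1 ≤ Finsupp.weight e m := by exact_mod_cast h2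
  omega

include hW he in
/-- The initial ideal for the weight given by the values of the generators: the components of its
elements are exactly those that take a larger value than expected. -/
theorem mem_initialIdeal_ker_aeval_iff (hs : HasSubduction k W b e) {P : MvPolynomial τ k} :
    P ∈ initialIdeal (fun j => (e j : ℚ)) (RingHom.ker (aeval b : MvPolynomial τ k →ₐ[k] A)) ↔
      ∀ ω : ℤ, (ω : WithTop ℤ) < W (aeval b (weightedHomogeneousComponent e ω P)) := by
  classical
  rw [mem_initialIdeal_iff]
  simp only [weight_intCast]
  constructor
  · intro h ω
    obtain ⟨Q, hQ, hm⟩ := h ω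
    have h1 : aeval b (weightedHomogeneousComponent e ω P) =
        - aeval b (Q - weightedHomogeneousComponent e ω P) := by
      rw [map_sub, (RingHom.mem_ker.1 hQ : aeval b Q = 0), zero_sub, neg_neg]
    rw [h1, AddValuation.map_neg]
    refine lt_of_lt_of_le (b := ((ω + 1 : ℤ) : WithTop ℤ)) (by exact_mod_cast lt_add_one ω)
      (le_map_aeval hW he fun m hmem => ?_)
    rw [mem_support_iff, coeff_sub, coeff_weightedHomogeneousComponent] at hmem
    have : ω < Finsupp.weight e m := by
      by_contra hle
      rcases (not_lt.1 hle).lt_or_eq with hlt | heq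
      · rw [if_neg hlt.ne, sub_zero] at hmem
        exact hmem ((hm m).1 (by exact_mod_cast hlt))
      · rw [if_pos heq, (hm m).2 (by exact_mod_cast heq), sub_self] at hmem
        exact hmem rfl
    exact_mod_cast this
  · intro h ω
    by_cases hω : ∃ z : ℤ, (z : ℚ) = ω
    · obtain ⟨z, rfl⟩ := hω
      -- Subduction rewrites the value of the component with terms of weight above `z` only, so the
      -- component minus `H` is a relation with the prescribed lowest part.
      obtain ⟨H, hH, hHw⟩ := hs (aeval b (weightedHomogeneousComponent e z P))
      have hcoeff : ∀ m, Finsupp.weight e m ≤ z → H.coeff m = 0 := by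
        intro m hm
        by_contra hc
        have h1 := (h z).trans_le (hHw m (mem_support_iff.2 hc))
        have h2 : z < Finsupp.weight e m := by exact_mod_cast h1
        omega
      refine ⟨weightedHomogeneousComponent e z P - H, ?_, fun m => ⟨fun hm => ?_, fun hm => ?_⟩⟩
      · rw [RingHom.mem_ker, map_sub]
        exact sub_eq_zero.2 hH.symm
      · have hm' : Finsupp.weight e m < z := by exact_mod_cast hm
        rw [coeff_sub, coeff_weightedHomogeneousComponent, if_neg hm'.ne, hcoeff m hm'.le,
          sub_zero]
      · have hm' : Finsupp.weight e m = z := by exact_mod_cast hm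
        rw [coeff_sub, coeff_weightedHomogeneousComponent, if_pos hm', hcoeff m hm'.le, sub_zero]
    · refine ⟨0, Ideal.zero_mem _, fun m => ⟨fun _ => coeff_zero _, fun hm => ?_⟩⟩
      exact absurd ⟨_, hm⟩ hω

attribute [local instance] MvPolynomial.weightedGradedAlgebra in
include hW he in
-- Primeness may be tested on weighted homogeneous elements. For these, membership means a value
-- strictly above the weight, and two factors whose values do not exceed their weights have a
-- product of the same kind.
theorem isPrime_initialIdeal_ker_aeval (hs : HasSubduction k W b e) :
    (initialIdeal (fun j => (e j : ℚ))
      (RingHom.ker (aeval b : MvPolynomial τ k →ₐ[k] A))).IsPrime := by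
  classical
  set I := initialIdeal (fun j => (e j : ℚ))
      (RingHom.ker (aeval b : MvPolynomial τ k →ₐ[k] A)) with hI
  have hom : ∀ {P : MvPolynomial τ k} {z : ℤ}, IsWeightedHomogeneous e P z →
      (P ∈ I ↔ (z : WithTop ℤ) < W (aeval b P)) := by
    intro P z hP
    rw [hI, mem_initialIdeal_ker_aeval_iff hW he hs]
    constructor
    · intro h
      simpa [hP.weightedHomogeneousComponent_same] using h z
    · intro h ω
      by_cases hω : ω = z
      · rwa [hω, hP.weightedHomogeneousComponent_same]
      · rw [hP.weightedHomogeneousComponent_ne ω hω, map_zero, AddValuation.map_zero]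
        exact WithTop.coe_lt_top _
  have hle : ∀ {P : MvPolynomial τ k} {z : ℤ}, IsWeightedHomogeneous e P z →
      (z : WithTop ℤ) ≤ W (aeval b P) := by
    intro P z hP
    refine le_map_aeval hW he fun m hm => ?_
    rw [hP (mem_support_iff.1 hm)]
  refine Ideal.IsHomogeneous.isPrime_of_homogeneous_mem_or_mem
    (𝒜 := weightedHomogeneousSubmodule k e) ?_ ?_ ?_
  · intro z P hP
    rw [← DirectSum.Decomposition.decompose'_eq, weightedDecomposition.decompose'_apply, hom
      (weightedHomogeneousComponent_isWeightedHomogeneous z P)]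
    exact (mem_initialIdeal_ker_aeval_iff hW he hs).1 hP z
  · rw [Ideal.ne_top_iff_one, hom (isWeightedHomogeneous_one k e)]
    simp
  · rintro x y ⟨i, hx⟩ ⟨j, hy⟩ hxy
    have hx' : IsWeightedHomogeneous e x i := hx
    have hy' : IsWeightedHomogeneous e y j := hy
    rw [hom (hx'.mul hy'), map_mul, AddValuation.map_mul] at hxy
    rw [hom hx', hom hy']
    by_contra! hcon
    have := add_le_add hcon.1 hcon.2
    exact absurd hxy (not_lt.2 (by exact_mod_cast this))

end Valued

/-! ### Subduction for Khovanskii bases -/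

section Subduction

open MvPolynomial

theorem decompose_aeval {k A : Type*} [Field k] [CommRing A] [Algebra k A]
    (𝒜 : ℕ → Submodule k A) [GradedAlgebra 𝒜] {d : ℕ} {b : Fin d → A} {deg : Fin d → ℕ}
    (hdeg : ∀ j, b j ∈ 𝒜 (deg j)) (p : MvPolynomial (Fin d) k) (m : ℕ) :
    (DirectSum.decompose 𝒜 (aeval b p) m : A) =
      aeval b (weightedHomogeneousComponent deg m p) := by
  classical
  induction p using MvPolynomial.induction_on' with
  | monomial u c =>
    have hmem : aeval b (monomial u c) ∈ 𝒜 (Finsupp.weight deg u) := by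
      rw [aeval_monomial, ← Algebra.smul_def, Finsupp.prod, Finsupp.weight_apply, Finsupp.sum]
      exact (𝒜 _).smul_mem _ (SetLike.prod_mem_graded 𝒜 _ _ fun j _ =>
        SetLike.pow_mem_graded _ (hdeg j))
    have hmon := isWeightedHomogeneous_monomial deg u c rfl
    by_cases h : m = Finsupp.weight deg u
    · subst h
      rw [DirectSum.decompose_of_mem_same 𝒜 hmem, hmon.weightedHomogeneousComponent_same]
    · rw [DirectSum.decompose_of_mem_ne 𝒜 hmem (Ne.symm h),
        hmon.weightedHomogeneousComponent_ne m h, map_zero]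
  | add p q hp hq => simp [hp, hq]

namespace Quasivaluation

variable {k A Ω : Type*} [Field k] [CommRing A] [Algebra k A] {v : Quasivaluation k A Ω}

/-- The valuation `f ↦ v f x`. -/
noncomputable def addValuationAt (hv : v.IsValuation) (x : Ω) : AddValuation A (WithTop ℤ) :=
  AddValuation.of (fun f => v f x) (v.map_zero x) (v.map_one_eq x)
    (fun f g => v.le_map_add f g x) (fun f g => hv f g x)

theorem addValuationAt_apply (hv : v.IsValuation) (x : Ω) (f : A) :
    addValuationAt hv x f = v f x := rfl

/-- The component in `G_r` of an element of `⨁ G_r`, as an element of `A`. -/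
def reesCoeff (x : Ω) (r : ℤ) : v.ReesAlgebra x →+ A where
  toFun z := ((show ⨁ r, v.filtration x r from z) r : A)
  map_zero' := rfl
  map_add' _ _ := rfl

theorem reesCoeff_reesOf (x : Ω) (r s : ℤ) (a : v.filtration x r) :
    reesCoeff x s (v.reesOf x r a) = if r = s then (a : A) else 0 :=
  (DirectSum.coe_of_apply (A := v.filtration x) r s a).trans (by split_ifs <;> rfl)

theorem reesCoeff_reesOf_mul (x : Ω) (r s : ℤ) (a : v.filtration x r) (z : v.ReesAlgebra x) :
    reesCoeff x s (v.reesOf x r a * z) = a * reesCoeff x (s - r) z :=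
  DirectSum.coe_of_mul_apply_aux (v.filtration x) a z
    (fun y => ⟨fun h => by omega, fun h => by omega⟩)

theorem reesAlgebra_induction {x : Ω} {motive : v.ReesAlgebra x → Prop}
    (zero : motive 0) (of : ∀ r a, motive (v.reesOf x r a))
    (add : ∀ y z, motive y → motive z → motive (y + z)) (z : v.ReesAlgebra x) : motive z :=
  DirectSum.induction_on (motive := motive) z zero of add

/-- A multiplier from `G_s` shifts the degree by `s` and raises the value by at least `s`, so the
strict inequality passes from the generators to the whole ideal. -/
theorem lt_reesCoeff_of_mem_gradedIdeal (hv : v.IsValuation) {x : Ω} {z : v.ReesAlgebra x}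
    (hz : z ∈ v.gradedIdeal x) (r : ℤ) : (r : WithTop ℤ) < v (reesCoeff x r z) x := by
  classical
  have hzero : ∀ r : ℤ, (r : WithTop ℤ) < v 0 x := fun r => by
    rw [v.map_zero]; exact WithTop.coe_lt_top r
  refine Submodule.span_induction
    (p := fun z _ => ∀ r : ℤ, (r : WithTop ℤ) < v (reesCoeff x r z) x) ?_ ?_ ?_ ?_ hz r
  · rintro _ ⟨s, a, ha, rfl⟩ r
    rw [reesCoeff_reesOf]
    split_ifs with h
    · rwa [← h]
    · exact hzero r
  · intro r
    rw [_root_.map_zero]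
    exact hzero r
  · intro y z _ _ hy hz r
    rw [map_add]
    exact (lt_min (hy r) (hz r)).trans_le (v.le_map_add _ _ x)
  · intro a z _ hz
    rw [smul_eq_mul]
    induction a using reesAlgebra_induction with
    | zero => intro r; rw [zero_mul, _root_.map_zero]; exact hzero r
    | of s a =>
      intro r
      rw [reesCoeff_reesOf_mul, hv]
      have h1 := WithTop.add_lt_add_of_le_of_lt (WithTop.coe_ne_top (a := s))
        (show ((s : ℤ) : WithTop ℤ) ≤ v (a : A) x from a.2) (hz (r - s))
      rwa [← WithTop.coe_add, add_sub_cancel] at h1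
    | add y y' hy hy' =>
      intro r
      rw [add_mul, map_add]
      exact (lt_min (hy r) (hy' r)).trans_le (v.le_map_add _ _ x)

theorem algebraMap_mem_filtration (x : Ω) (c : k) : algebraMap k A c ∈ v.filtration x 0 := by
  rw [Algebra.algebraMap_eq_smul_one]
  exact (v.filtration x 0).smul_mem c (v.map_one_eq x).ge

variable {d : ℕ} {b : Fin d → A} {x : Ω} {e : Fin d → ℤ}

/-- The map from the polynomial ring to `⨁ G_r` that sends `y_j` to the element `b_j` of degree
its value. -/
noncomputable def reesAeval (he : ∀ j, v (b j) x = e j) :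
    MvPolynomial (Fin d) k →ₐ[k] v.ReesAlgebra x :=
  aeval fun j => v.reesOf x (e j) ⟨b j, (he j).ge⟩

theorem reesCoeff_reesAeval (he : ∀ j, v (b j) x = e j) (r : ℤ) (p : MvPolynomial (Fin d) k) :
    reesCoeff x r (reesAeval he p) = aeval b (weightedHomogeneousComponent e r p) := by
  classical
  suffices h : ∀ p : MvPolynomial (Fin d) k, ∀ r, reesCoeff x r (reesAeval he p) =
      aeval b (weightedHomogeneousComponent e r p) from h p r
  intro p
  induction p using MvPolynomial.induction_on with
  | C a =>
    intro r
    have h : reesAeval he (C a) =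
        v.reesOf x 0 ⟨algebraMap k A a, algebraMap_mem_filtration x a⟩ := by
      rw [← algebraMap_eq, AlgHom.commutes]
      rfl
    rw [h, reesCoeff_reesOf]
    by_cases hr : r = 0
    · subst hr
      rw [(isWeightedHomogeneous_C e a).weightedHomogeneousComponent_same]
      simp
    · rw [(isWeightedHomogeneous_C e a).weightedHomogeneousComponent_ne r hr, _root_.map_zero,
        if_neg (Ne.symm hr)]
  | add p q hp hq => intro r; simp [hp, hq]
  | mul_X p j hp =>
    intro r
    have h : weightedHomogeneousComponent e r (p * X j) =
        X j * weightedHomogeneousComponent e (r - e j) p := by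
      ext m
      rw [mul_comm, coeff_weightedHomogeneousComponent, coeff_X_mul', coeff_X_mul',
        coeff_weightedHomogeneousComponent]
      by_cases hj : j ∈ m.support
      · have hw : Finsupp.weight e m = Finsupp.weight e (m - Finsupp.single j 1) + e j := by
          conv_lhs => rw [← tsub_add_cancel_of_le (show Finsupp.single j 1 ≤ m by
            rw [Finsupp.single_le_iff]
            exact Nat.one_le_iff_ne_zero.2 (Finsupp.mem_support_iff.1 hj))]
          rw [map_add, Finsupp.weight_single, one_smul]
        simp only [hj, if_true, hw, eq_sub_iff_add_eq]
      · simp [hj]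
    rw [h, mul_comm p, map_mul, map_mul (aeval b), aeval_X, ← hp,
      show reesAeval he (X j) = v.reesOf x (e j) ⟨b j, (he j).ge⟩ from aeval_X _ _,
      reesCoeff_reesOf_mul]

/-- The Khovanskii property says that the composite of `reesAeval` with the quotient map to the
associated graded algebra is surjective. -/
theorem reesOf_sub_mem_of_isKhovanskiiBasisAt (he : ∀ j, v (b j) x = e j)
    (hb : v.IsKhovanskiiBasisAt (Set.range b) x) (z : v.ReesAlgebra x) :
    ∃ p : MvPolynomial (Fin d) k, reesAeval he p - z ∈ v.gradedIdeal x := by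
  have h : Ideal.Quotient.mkₐ k (v.gradedIdeal x) z ∈
      ((Ideal.Quotient.mkₐ k (v.gradedIdeal x)).comp (reesAeval he)).range := by
    have hle : Algebra.adjoin k {y : v.associatedGraded x | ∃ (r : ℤ) (a : v.filtration x r),
        a.1 ∈ Set.range b ∧ v a.1 x = r ∧ y = Ideal.Quotient.mk _ (v.reesOf x r a)} ≤
        ((Ideal.Quotient.mkₐ k (v.gradedIdeal x)).comp (reesAeval he)).range := by
      refine Algebra.adjoin_le ?_
      rintro _ ⟨r, ⟨a, ha⟩, ⟨j, hj⟩, hr, rfl⟩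
      change b j = a at hj
      subst hj
      have : r = e j := by
        have := hr.symm.trans (he j)
        exact_mod_cast this
      subst this
      exact ⟨X j, by simp [reesAeval]⟩
    rw [show Algebra.adjoin k _ = ⊤ from hb] at hle
    exact hle trivial
  obtain ⟨p, hp⟩ := h
  exact ⟨p, Ideal.Quotient.eq.1 hp⟩

/-- One step of subduction: the class of `f` in degree `s` is a polynomial in the classes of the `b
j`, and the part of weight `s` of a lift cancels the leading part of `f`. -/
theorem exists_approximation (hv : v.IsValuation) (he : ∀ j, v (b j) x = e j)
    (hb : v.IsKhovanskiiBasisAt (Set.range b) x) {f : A} {s : ℤ} (hs : v f x = s) :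
    ∃ p : MvPolynomial (Fin d) k, IsWeightedHomogeneous e p s ∧ v f x < v (f - aeval b p) x := by
  classical
  obtain ⟨p, hp⟩ := reesOf_sub_mem_of_isKhovanskiiBasisAt he hb (v.reesOf x s ⟨f, hs.ge⟩)
  refine ⟨_, weightedHomogeneousComponent_isWeightedHomogeneous s p, ?_⟩
  have h := lt_reesCoeff_of_mem_gradedIdeal hv hp s
  rw [map_sub, reesCoeff_reesAeval, reesCoeff_reesOf, if_pos rfl,
    ← addValuationAt_apply hv, AddValuation.map_sub_swap] at h
  rw [hs]
  exact h

variable (𝒜 : ℕ → Submodule k A) [GradedAlgebra 𝒜]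

theorem le_decompose (hvhom : v.IsHomogeneous 𝒜) (f : A) (m : ℕ) :
    v f x ≤ v (DirectSum.decompose 𝒜 f m : A) x := by
  classical
  by_cases h : DirectSum.decompose 𝒜 f m = 0
  · rw [h, ZeroMemClass.coe_zero, v.map_zero]
    exact le_top
  · rw [hvhom f x]
    exact Finset.inf_le (DFinsupp.mem_support_iff.2 h)

/-- Subduction: over a Khovanskii basis every element is a polynomial all of whose terms have at
least its value. It terminates since the pieces of the grading are finite-dimensional. -/
theorem hasSubduction_of_isKhovanskiiBasisAt (h𝒜 : ∀ m, Module.Finite k (𝒜 m))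
    (hv : v.IsValuation) (hvhom : v.IsHomogeneous 𝒜) (hfin : ∀ f, f ≠ 0 → v f x ≠ ⊤)
    (hbhom : ∀ j, ∃ m, b j ∈ 𝒜 m) (he : ∀ j, v (b j) x = e j)
    (hb : v.IsKhovanskiiBasisAt (Set.range b) x) :
    HasSubduction k (addValuationAt hv x) b e := by
  classical
  choose deg hdeg using hbhom
  -- Induction on a bound `D` for the dimension of `A_m ∩ G_s`. It drops when the value rises from
  -- `s` to `t`, since `f` lies in `G_s` but not in `G_t`.
  have key : ∀ m, ∀ D : ℕ, ∀ f ∈ 𝒜 m, ∀ s : ℤ, v f x = s →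
      Module.finrank k ↥(𝒜 m ⊓ v.filtration x s) ≤ D →
      ∃ p : MvPolynomial (Fin d) k, aeval b p = f ∧
        ∀ m ∈ p.support, v f x ≤ (Finsupp.weight e m : ℤ) := by
    intro m D
    have := h𝒜 m
    induction D with
    | zero =>
      intro f hf s hs hD
      have hbot : 𝒜 m ⊓ v.filtration x s = ⊥ := by
        have : Module.Finite k ↥(𝒜 m ⊓ v.filtration x s) :=
          Submodule.finiteDimensional_of_le inf_le_left
        exact Submodule.finrank_eq_zero.1 (Nat.le_zero.1 hD)
      have h0 : f ∈ 𝒜 m ⊓ v.filtration x s := ⟨hf, hs.ge⟩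
      rw [hbot, Submodule.mem_bot] at h0
      exact ⟨0, by simp [h0], by simp⟩
    | succ D ih =>
      intro f hf s hs hD
      obtain ⟨p, hp, hlt⟩ := exists_approximation hv he hb hs
      -- Passing to the part of degree `m` keeps the remainder in `A_m`; by homogeneity of `v` this
      -- does not lower its value.
      set q := weightedHomogeneousComponent deg m p with hq
      have hqw : ∀ u ∈ q.support, v f x ≤ (Finsupp.weight e u : ℤ) := by
        intro u hu
        rw [mem_support_iff, hq, coeff_weightedHomogeneousComponent] at hu
        rw [hs, hp (by by_contra h0; simp [h0] at hu : p.coeff u ≠ 0)]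
      have hg : f - aeval b q = (DirectSum.decompose 𝒜 (f - aeval b p) m : A) := by
        rw [DirectSum.decompose_sub, DirectSum.sub_apply, AddSubgroupClass.coe_sub,
          decompose_aeval 𝒜 hdeg, DirectSum.decompose_of_mem_same 𝒜 hf]
      have hglt : v f x < v (f - aeval b q) x :=
        hlt.trans_le (by rw [hg]; exact le_decompose 𝒜 hvhom _ m)
      by_cases hg0 : f - aeval b q = 0
      · exact ⟨q, (sub_eq_zero.1 hg0).symm, hqw⟩
      · obtain ⟨t, ht⟩ := WithTop.ne_top_iff_exists.1 (hfin _ hg0)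
        have hst : s < t := by
          rw [hs, ← ht] at hglt
          exact_mod_cast hglt
        obtain ⟨p', hp', hp'w⟩ := ih (f - aeval b q) (by rw [hg]; exact SetLike.coe_mem _) t
          ht.symm (by
            refine Nat.le_of_lt_succ (lt_of_lt_of_le ?_ hD)
            have : Module.Finite k ↥(𝒜 m ⊓ v.filtration x s) :=
              Submodule.finiteDimensional_of_le inf_le_left
            refine Submodule.finrank_lt_finrank_of_lt (lt_of_le_of_ne ?_ ?_)
            · refine inf_le_inf_left _ fun g hg => ?_
              exact le_trans (by exact_mod_cast hst.le) (show (t : WithTop ℤ) ≤ v g x from hg)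
            · intro heq
              have h1 : f ∈ 𝒜 m ⊓ v.filtration x s := ⟨hf, hs.ge⟩
              rw [← heq] at h1
              have h2 : (t : WithTop ℤ) ≤ v f x := h1.2
              rw [hs] at h2
              exact absurd hst (not_lt.2 (by exact_mod_cast h2)))
        refine ⟨q + p', by rw [map_add, hp']; ring, fun u hu => ?_⟩
        rcases Finset.mem_union.1 (support_add hu) with hu | hu
        · exact hqw u hu
        · exact hglt.le.trans (hp'w u hu)
  intro f
  have hcomp : ∀ m, ∃ p : MvPolynomial (Fin d) k, aeval b p = (DirectSum.decompose 𝒜 f m : A) ∧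
      ∀ u ∈ p.support, v f x ≤ (Finsupp.weight e u : ℤ) := by
    intro m
    by_cases h0 : (DirectSum.decompose 𝒜 f m : A) = 0
    · exact ⟨0, by simp [h0], by simp⟩
    · obtain ⟨t, ht⟩ := WithTop.ne_top_iff_exists.1 (hfin _ h0)
      obtain ⟨p, hp, hpw⟩ := key m _ _ (SetLike.coe_mem _) t ht.symm le_rfl
      exact ⟨p, hp, fun u hu => (le_decompose 𝒜 hvhom f m).trans (hpw u hu)⟩
  choose p hp hpw using hcomp
  refine ⟨∑ m ∈ (DirectSum.decompose 𝒜 f).support, p m, ?_, fun u hu => ?_⟩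
  · rw [map_sum]
    simp only [hp]
    exact DirectSum.sum_support_decompose 𝒜 f
  · obtain ⟨m, -, hm⟩ := Finset.mem_biUnion.1 (support_sum hu)
    exact hpw m u hm

end Quasivaluation

end Subduction

/-! ### Homogenization with respect to an integer matrix -/

section Rees

open MvPolynomial

variable {n d : ℕ} (D : Fin n → Fin d → ℤ)

/-- The multidegrees of the variables `Y_j` and `X_i`: the `j`-th column of `D`, and `-e_i`. -/
def columnDegree : Fin d ⊕ Fin n → Fin n → ℤ :=
  Sum.elim (fun j i => D i j) (fun i => -Pi.single i 1)

/-- The map `Y_j ↦ c_j t^{D_j}`, `X_i ↦ t_i⁻¹`. -/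
noncomputable def reesHom (k : Type*) {E : Type*} [Field k] [CommRing E] [Algebra k E]
    (c : Fin d → E) :
    MvPolynomial (Fin d ⊕ Fin n) k →ₐ[k] AddMonoidAlgebra E (Fin n → ℤ) :=
  aeval (Sum.elim (fun j => AddMonoidAlgebra.single (fun i => D i j) (c j))
    (fun i => AddMonoidAlgebra.single (-Pi.single i 1) 1))

/-- The substitution `X_i = 1`. -/
noncomputable def dehomogenize (k : Type*) [Field k] (n d : ℕ) :
    MvPolynomial (Fin d ⊕ Fin n) k →ₐ[k] MvPolynomial (Fin d) k :=
  aeval (Sum.elim X 1)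

/-- The exponents of the variables `Y_j` in a monomial. -/
noncomputable def yPart : (Fin d ⊕ Fin n →₀ ℕ) →+ (Fin d →₀ ℕ) :=
  Finsupp.comapDomain.addMonoidHom Sum.inl_injective

theorem yPart_apply (m : Fin d ⊕ Fin n →₀ ℕ) (j : Fin d) : yPart m j = m (Sum.inl j) := rfl

theorem weight_columnDegree (m : Fin d ⊕ Fin n →₀ ℕ) (i : Fin n) :
    Finsupp.weight (columnDegree D) m i = Finsupp.weight (D i) (yPart m) - m (Sum.inr i) := by
  rw [Finsupp.weight_apply, Finsupp.weight_apply, Finsupp.sum_fintype _ _ (by simp),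
    Finsupp.sum_fintype _ _ (by simp), Finset.sum_apply, Fintype.sum_sum_type, sub_eq_add_neg]
  congr 1
  simp [columnDegree, Pi.single_apply]

/-- The `i`-th entry of the multidegree recovers the exponent of `X_i`. This is why setting `X = 1`
loses nothing within one multidegree. -/
theorem eq_of_yPart_eq {m m' : Fin d ⊕ Fin n →₀ ℕ} (hy : yPart m = yPart m')
    (hd : Finsupp.weight (columnDegree D) m = Finsupp.weight (columnDegree D) m') : m = m' := by
  ext (j | i)
  · exact DFunLike.congr_fun hy j
  · have h := congrFun hd i
    rw [weight_columnDegree, weight_columnDegree, hy] at h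
    omega

/-- The projection of weights along the lineality space given by the multigrading. -/
def reesProj (u : Fin d ⊕ Fin n → ℚ) : Fin d → ℚ :=
  fun j => u (Sum.inl j) + ∑ i, (D i j : ℚ) * u (Sum.inr i)

/-- The subtracted sum depends only on the multidegree, so `u` and its projection order the terms of
a multihomogeneous polynomial in the same way. -/
theorem weight_eq_reesProj (u : Fin d ⊕ Fin n → ℚ) (m : Fin d ⊕ Fin n →₀ ℕ) :
    Finsupp.weight u m = Finsupp.weight (reesProj D u) (yPart m) -
      ∑ i, (Finsupp.weight (columnDegree D) m i : ℚ) * u (Sum.inr i) := by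
  simp only [weight_columnDegree]
  have h : ∀ (σ : Type) [Fintype σ] (w : σ → ℚ) (m : σ →₀ ℕ),
      Finsupp.weight w m = ∑ i, (m i : ℚ) * w i := fun σ _ w m => by
    rw [Finsupp.weight_apply, Finsupp.sum_fintype _ _ fun i => zero_nsmul (w i)]
    simp only [nsmul_eq_mul]
  have h' : ∀ i, ((Finsupp.weight (D i) (yPart m) : ℤ) : ℚ) =
      ∑ j, (m (Sum.inl j) : ℚ) * (D i j : ℚ) := fun i => by
    rw [← weight_intCast, h]
    rfl
  rw [h, h, Fintype.sum_sum_type]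
  push_cast
  simp only [h', reesProj, yPart_apply, mul_add, sub_mul, Finset.sum_add_distrib,
    Finset.sum_sub_distrib, Finset.mul_sum, Finset.sum_mul]
  rw [Finset.sum_comm (f := fun j i => (m (Sum.inl j) : ℚ) * ((D i j : ℚ) * u (Sum.inr i)))]
  simp only [mul_assoc]
  ring

theorem reesProj_tropSection (w : Fin d → ℚ) : reesProj D (tropSection n w) = w := by
  ext j
  simp [reesProj, tropSection]

theorem weight_tropSection (w : Fin d → ℚ) (m : Fin d ⊕ Fin n →₀ ℕ) :
    Finsupp.weight (tropSection n w) m = Finsupp.weight w (yPart m) := by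
  -- The claim does not involve `D`, so any matrix serves.
  rw [weight_eq_reesProj (0 : Fin n → Fin d → ℤ), reesProj_tropSection]
  simp [tropSection]

variable {k E : Type*} [Field k] [CommRing E] [Algebra k E]

theorem dehomogenize_monomial (m : Fin d ⊕ Fin n →₀ ℕ) (a : k) :
    dehomogenize k n d (monomial m a) = monomial (yPart m) a := by
  rw [dehomogenize, aeval_monomial, monomial_eq, algebraMap_eq,
    Finsupp.prod_fintype _ _ (by simp), Finsupp.prod_fintype _ _ (by simp),
    Fintype.prod_sum_type]
  simp [yPart_apply]

/-- Terms of one multidegree have distinct `Y`-parts, so nothing cancels. -/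
theorem coeff_dehomogenize {P : MvPolynomial (Fin d ⊕ Fin n) k} {δ : Fin n → ℤ}
    (hP : IsWeightedHomogeneous (columnDegree D) P δ) {m : Fin d ⊕ Fin n →₀ ℕ}
    (hm : Finsupp.weight (columnDegree D) m = δ) :
    (dehomogenize k n d P).coeff (yPart m) = P.coeff m := by
  classical
  conv_lhs => rw [P.as_sum, map_sum]
  simp only [dehomogenize_monomial, coeff_sum, coeff_monomial]
  rw [Finset.sum_eq_single m]
  · simp
  · intro m' hm' hne
    rw [if_neg]
    intro h
    exact hne (eq_of_yPart_eq D h ((hP (mem_support_iff.1 hm')).trans hm.symm))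
  · intro h
    simp [notMem_support_iff.1 h]

theorem exists_mem_support_of_dehomogenize {P : MvPolynomial (Fin d ⊕ Fin n) k}
    {α : Fin d →₀ ℕ} (h : α ∈ (dehomogenize k n d P).support) : ∃ m ∈ P.support, yPart m = α := by
  classical
  by_contra! hcon
  rw [mem_support_iff, P.as_sum, map_sum, coeff_sum] at h
  refine h (Finset.sum_eq_zero fun m hm => ?_)
  rw [dehomogenize_monomial, coeff_monomial, if_neg (hcon m hm)]

theorem yPart_single_inl (j : Fin d) (q : ℕ) :
    yPart (Finsupp.single (Sum.inl j : Fin d ⊕ Fin n) q) = Finsupp.single j q := by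
  classical
  ext j'
  simp [yPart_apply, Finsupp.single_apply]

theorem yPart_single_inr (i : Fin n) (q : ℕ) :
    yPart (Finsupp.single (Sum.inr i : Fin d ⊕ Fin n) q) = 0 := by
  ext j'
  simp [yPart_apply]

theorem reesHom_monomial (c : Fin d → E) (m : Fin d ⊕ Fin n →₀ ℕ) (a : k) :
    reesHom D k c (monomial m a) = AddMonoidAlgebra.single (Finsupp.weight (columnDegree D) m)
      (aeval c (dehomogenize k n d (monomial m a))) := by
  have key : (m.prod fun i q => (Sum.elim
      (fun j => AddMonoidAlgebra.single (fun i => D i j) (c j))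
      (fun i => AddMonoidAlgebra.single (-Pi.single i 1) 1) i) ^ q) =
      AddMonoidAlgebra.single (Finsupp.weight (columnDegree D) m)
        ((yPart m).prod fun j q => c j ^ q) := by
    induction m using Finsupp.induction_linear with
    | zero => simp [AddMonoidAlgebra.one_def]
    | add m m' hm hm' =>
      rw [Finsupp.prod_add_index' (by simp) (fun _ _ _ => pow_add _ _ _), hm, hm',
        AddMonoidAlgebra.single_mul_single, map_add, map_add,
        Finsupp.prod_add_index' (by simp) (fun _ _ _ => pow_add _ _ _)]
    | single i q =>
      rw [Finsupp.prod_single_index (by simp), Finsupp.weight_single]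
      rcases i with j | i
      · rw [yPart_single_inl, Finsupp.prod_single_index (by simp), Sum.elim_inl,
          AddMonoidAlgebra.single_pow]
        rfl
      · rw [yPart_single_inr, Sum.elim_inr, AddMonoidAlgebra.single_pow, one_pow]
        rfl
  rw [dehomogenize_monomial, aeval_monomial, reesHom, aeval_monomial, key,
    ← Algebra.smul_def, ← Algebra.smul_def, AddMonoidAlgebra.smul_single]

theorem reesHom_apply (c : Fin d → E) (P : MvPolynomial (Fin d ⊕ Fin n) k) (δ : Fin n → ℤ) :
    (reesHom D k c P).coeff δ =
      aeval c (dehomogenize k n d (weightedHomogeneousComponent (columnDegree D) δ P)) := by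
  classical
  induction P using MvPolynomial.induction_on' with
  | monomial m a =>
    rw [reesHom_monomial]
    have hmon := isWeightedHomogeneous_monomial (columnDegree D) m a rfl
    by_cases h : δ = Finsupp.weight (columnDegree D) m
    · rw [h, hmon.weightedHomogeneousComponent_same]
      simp
    · rw [hmon.weightedHomogeneousComponent_ne δ h, map_zero, map_zero]
      simp [Ne.symm h]
  | add p q hp hq => simp [hp, hq]

theorem reesHom_of_isWeightedHomogeneous (c : Fin d → E) {P : MvPolynomial (Fin d ⊕ Fin n) k}
    {δ : Fin n → ℤ} (hP : IsWeightedHomogeneous (columnDegree D) P δ) :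
    reesHom D k c P = AddMonoidAlgebra.single δ (aeval c (dehomogenize k n d P)) := by
  classical
  ext δ'
  rw [reesHom_apply]
  by_cases h : δ' = δ
  · rw [h, hP.weightedHomogeneousComponent_same]
    simp
  · rw [hP.weightedHomogeneousComponent_ne δ' h, map_zero, map_zero]
    simp [Ne.symm h]

/-- The homogenization of `p` of multidegree `δ`. -/
noncomputable def homogenize (δ : Fin n → ℤ) (p : MvPolynomial (Fin d) k) :
    MvPolynomial (Fin d ⊕ Fin n) k :=
  ∑ α ∈ p.support, monomial
    (Finsupp.sumElim α (Finsupp.equivFunOnFinite.symm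
      fun i => (Finsupp.weight (D i) α - δ i).toNat)) (p.coeff α)

theorem yPart_sumElim (α : Fin d →₀ ℕ) (a : Fin n →₀ ℕ) : yPart (Finsupp.sumElim α a) = α := by
  ext j
  rw [yPart_apply, Finsupp.sumElim_inl]

theorem dehomogenize_homogenize (δ : Fin n → ℤ) (p : MvPolynomial (Fin d) k) :
    dehomogenize k n d (homogenize D δ p) = p := by
  rw [homogenize, map_sum]
  simp only [dehomogenize_monomial, yPart_sumElim]
  exact p.as_sum.symm

/-- The bound `h` makes the truncation by `toNat` in `homogenize` harmless. -/
theorem isWeightedHomogeneous_homogenize {δ : Fin n → ℤ} {p : MvPolynomial (Fin d) k}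
    (h : ∀ α ∈ p.support, ∀ i, δ i ≤ Finsupp.weight (D i) α) :
    IsWeightedHomogeneous (columnDegree D) (homogenize D δ p) δ := by
  refine IsWeightedHomogeneous.sum _ _ _ fun α hα => isWeightedHomogeneous_monomial _ _ _ ?_
  ext i
  rw [weight_columnDegree, yPart_sumElim, Finsupp.sumElim_inr]
  have := h α hα i
  simp only [Finsupp.equivFunOnFinite_symm_apply_apply]
  omega

theorem reesHom_homogenize (c : Fin d → E) {δ : Fin n → ℤ} {p : MvPolynomial (Fin d) k}
    (h : ∀ α ∈ p.support, ∀ i, δ i ≤ Finsupp.weight (D i) α) :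
    reesHom D k c (homogenize D δ p) = AddMonoidAlgebra.single δ (aeval c p) := by
  rw [reesHom_of_isWeightedHomogeneous D c (isWeightedHomogeneous_homogenize D h),
    dehomogenize_homogenize]

theorem exists_le_weight (s : Finset (Fin d →₀ ℕ)) (r : Fin n → ℤ) :
    ∃ δ : Fin n → ℤ, δ ≤ r ∧ ∀ α ∈ s, ∀ i, δ i ≤ Finsupp.weight (D i) α := by
  classical
  have : ∀ i, ∃ z : ℤ, ∀ y ∈ insert (r i) (s.image (Finsupp.weight (D i))), z ≤ y :=
    fun i => (Finset.exists_le (α := ℤᵒᵈ) _)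
  choose δ hδ using this
  exact ⟨δ, fun i => hδ i _ (Finset.mem_insert_self _ _),
    fun α hα i => hδ i _ (Finset.mem_insert_of_mem (Finset.mem_image_of_mem _ hα))⟩

/-! ### Initial ideals and tropical varieties under homogenization -/

variable (b : Fin d → E)

theorem mem_ker_reesHom_iff {P : MvPolynomial (Fin d ⊕ Fin n) k} :
    P ∈ RingHom.ker (reesHom D k b) ↔ ∀ δ,
      dehomogenize k n d (weightedHomogeneousComponent (columnDegree D) δ P) ∈
        presentationIdeal k b := by
  rw [RingHom.mem_ker]
  constructor
  · intro h δ
    rw [presentationIdeal, RingHom.mem_ker]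
    exact (reesHom_apply D b P δ).symm.trans (by rw [h]; rfl)
  · intro h
    ext δ
    exact (reesHom_apply D b P δ).trans (h δ)

theorem homogeneousComponent_mem_ker_reesHom {P : MvPolynomial (Fin d ⊕ Fin n) k}
    (hP : P ∈ RingHom.ker (reesHom D k b)) (δ : Fin n → ℤ) :
    weightedHomogeneousComponent (columnDegree D) δ P ∈ RingHom.ker (reesHom D k b) := by
  rw [RingHom.mem_ker, reesHom_of_isWeightedHomogeneous D b
    (weightedHomogeneousComponent_isWeightedHomogeneous δ P), ← reesHom_apply,
    (RingHom.mem_ker.1 hP : reesHom D k b P = 0)]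
  simp

theorem homogenize_mem_ker_reesHom {p : MvPolynomial (Fin d) k} (hp : p ∈ presentationIdeal k b)
    {δ : Fin n → ℤ} (h : ∀ α ∈ p.support, ∀ i, δ i ≤ Finsupp.weight (D i) α) :
    homogenize D δ p ∈ RingHom.ker (reesHom D k b) := by
  rw [RingHom.mem_ker, reesHom_homogenize D b h, (RingHom.mem_ker.1 hp : aeval b p = 0)]
  simp

/-- A relation and its homogenization have matching terms, with weights differing by a constant.
Conversely, a term of `P` is compared only with terms of its own multidegree. -/
theorem mem_tropicalVariety_ker_reesHom_iff {u : Fin d ⊕ Fin n → ℚ} :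
    u ∈ tropicalVariety (RingHom.ker (reesHom D k b)) ↔
      reesProj D u ∈ tropicalVariety (presentationIdeal k b) := by
  classical
  constructor
  · intro h p hp α hα
    obtain ⟨δ, -, hδ⟩ := exists_le_weight D p.support 0
    have hhom := isWeightedHomogeneous_homogenize D hδ
    have hα' : α ∈ (dehomogenize k n d (homogenize D δ p)).support := by
      rwa [dehomogenize_homogenize]
    obtain ⟨m, hm, rfl⟩ := exists_mem_support_of_dehomogenize hα'
    obtain ⟨m', hm', hne, hle⟩ := h _ (homogenize_mem_ker_reesHom D b hp hδ) m hm
    have hd := hhom (mem_support_iff.1 hm)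
    have hd' := hhom (mem_support_iff.1 hm')
    refine ⟨yPart m', ?_, fun he => hne (eq_of_yPart_eq D he (hd'.trans hd.symm)), ?_⟩
    · rw [mem_support_iff]
      nth_rewrite 1 [← dehomogenize_homogenize D δ p]
      rw [coeff_dehomogenize D hhom hd']
      exact mem_support_iff.1 hm'
    · rw [weight_eq_reesProj D, weight_eq_reesProj D, hd, hd'] at hle
      linarith
  · intro h P hP m hm
    set δ := Finsupp.weight (columnDegree D) m with hδ
    have hhom := weightedHomogeneousComponent_isWeightedHomogeneous (w := columnDegree D) δ P
    have hmem : yPart m ∈ (dehomogenize k n d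
        (weightedHomogeneousComponent (columnDegree D) δ P)).support := by
      rw [mem_support_iff, coeff_dehomogenize D hhom rfl, coeff_weightedHomogeneousComponent,
        if_pos rfl]
      exact mem_support_iff.1 hm
    obtain ⟨α, hα, hne, hle⟩ := h _ ((mem_ker_reesHom_iff D b).1 hP δ) _ hmem
    obtain ⟨m', hm', rfl⟩ := exists_mem_support_of_dehomogenize hα
    have hd' := hhom (mem_support_iff.1 hm')
    refine ⟨m', ?_, fun he => hne (by rw [he]), ?_⟩
    · rw [mem_support_iff, coeff_weightedHomogeneousComponent, if_pos hd'] at hm'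
      exact mem_support_iff.2 hm'
    · rw [weight_eq_reesProj D, weight_eq_reesProj D u m, hd', ← hδ]
      linarith

theorem dehomogenize_mem_initialIdeal {w : Fin d → ℚ} {P : MvPolynomial (Fin d ⊕ Fin n) k}
    (hP : P ∈ initialIdeal (tropSection n w) (RingHom.ker (reesHom D k b))) (δ : Fin n → ℤ) :
    dehomogenize k n d (weightedHomogeneousComponent (columnDegree D) δ P) ∈
      initialIdeal w (presentationIdeal k b) := by
  classical
  rw [mem_initialIdeal_iff] at hP ⊢
  intro ω
  obtain ⟨Q, hQ, h⟩ := hP ω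
  have hPh := weightedHomogeneousComponent_isWeightedHomogeneous (w := columnDegree D) δ P
  have hQh := weightedHomogeneousComponent_isWeightedHomogeneous (w := columnDegree D) δ Q
  refine ⟨_, (mem_ker_reesHom_iff D b).1 hQ δ, fun α => ?_⟩
  -- An exponent that does not lift to multidegree `δ` has coefficient zero in both
  -- dehomogenizations.
  by_cases hα : ∃ m : Fin d ⊕ Fin n →₀ ℕ, yPart m = α ∧ Finsupp.weight (columnDegree D) m = δ
  · obtain ⟨m, rfl, hm⟩ := hα
    rw [coeff_dehomogenize D hPh hm, coeff_dehomogenize D hQh hm,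
      coeff_weightedHomogeneousComponent, coeff_weightedHomogeneousComponent, if_pos hm,
      if_pos hm, ← weight_tropSection (n := n)]
    exact h m
  · have hz : ∀ R : MvPolynomial (Fin d ⊕ Fin n) k, (dehomogenize k n d
        (weightedHomogeneousComponent (columnDegree D) δ R)).coeff α = 0 := by
      intro R
      by_contra hc
      obtain ⟨m, hm, he⟩ := exists_mem_support_of_dehomogenize (mem_support_iff.2 hc)
      exact hα ⟨m, he, (weightedHomogeneousComponent_isWeightedHomogeneous
        (w := columnDegree D) δ R) (mem_support_iff.1 hm)⟩
    simp [hz]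

/-- On multidegree `δ` the weights `u` and `u'` differ by the constant `s`, and the kernel is
multihomogeneous, so the lowest parts agree up to a shift of the weight. -/
theorem initialIdeal_le_of_reesProj_eq {u u' : Fin d ⊕ Fin n → ℚ}
    (h : reesProj D u = reesProj D u') :
    initialIdeal u (RingHom.ker (reesHom D k b)) ≤
      initialIdeal u' (RingHom.ker (reesHom D k b)) := by
  classical
  intro P hP
  refine mem_of_weightedHomogeneousComponent_mem (columnDegree D) fun δ => ?_
  rw [mem_initialIdeal_iff] at hP ⊢
  intro ω
  set s := ∑ i, (δ i : ℚ) * u' (Sum.inr i) - ∑ i, (δ i : ℚ) * u (Sum.inr i) with hs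
  obtain ⟨Q, hQ, hm⟩ := hP (ω + s)
  refine ⟨_, homogeneousComponent_mem_ker_reesHom D b hQ δ, fun m => ?_⟩
  rw [coeff_weightedHomogeneousComponent, coeff_weightedHomogeneousComponent]
  split_ifs with hδ
  · have hw : Finsupp.weight u m = Finsupp.weight u' m + s := by
      rw [weight_eq_reesProj D, weight_eq_reesProj D u', h, hδ, hs]
      ring
    exact ⟨fun hlt => (hm m).1 (by rw [hw]; linarith), fun heq => (hm m).2 (by rw [hw, heq])⟩
  · simp

theorem initialIdeal_tropSection_reesProj (u : Fin d ⊕ Fin n → ℚ) :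
    initialIdeal (tropSection n (reesProj D u)) (RingHom.ker (reesHom D k b)) =
      initialIdeal u (RingHom.ker (reesHom D k b)) :=
  le_antisymm (initialIdeal_le_of_reesProj_eq D b (reesProj_tropSection D _))
    (initialIdeal_le_of_reesProj_eq D b (reesProj_tropSection D _).symm)

/-- Homogenization in a multidegree bounded by all terms of `p` commutes with taking the initial
form, so every generator downstairs is the image of one upstairs. -/
theorem map_dehomogenize_initialIdeal (w : Fin d → ℚ) :
    (initialIdeal (tropSection n w) (RingHom.ker (reesHom D k b))).map (dehomogenize k n d) =
      initialIdeal w (presentationIdeal k b) := by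
  classical
  apply le_antisymm
  · rw [Ideal.map_le_iff_le_comap]
    intro P hP
    rw [Ideal.mem_comap, ← sum_weightedHomogeneousComponent_image (columnDegree D) P, map_sum]
    exact Ideal.sum_mem _ fun δ _ => dehomogenize_mem_initialIdeal D b hP δ
  · refine Ideal.span_le.2 ?_
    rintro _ ⟨p, hp, rfl⟩
    obtain ⟨δ, -, hδ⟩ := exists_le_weight D p.support 0
    have hsupp : (initialForm w p).support ⊆ p.support := by
      intro α hα
      rw [mem_support_iff, coeff_initialForm] at hα
      exact mem_support_iff.2 fun h0 => hα (by simp [h0])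
    have hhom := isWeightedHomogeneous_homogenize D hδ
    have hhom' := isWeightedHomogeneous_homogenize D (p := initialForm w p)
      fun α hα => hδ α (hsupp hα)
    rw [SetLike.mem_coe, ← dehomogenize_homogenize D δ (initialForm w p)]
    refine Ideal.mem_map_of_mem _ ?_
    suffices h : homogenize D δ (initialForm w p) =
        initialForm (tropSection n w) (homogenize D δ p) by
      rw [h]
      exact Ideal.subset_span ⟨_, homogenize_mem_ker_reesHom D b hp hδ, rfl⟩
    ext m
    rw [coeff_initialForm]
    by_cases hm : Finsupp.weight (columnDegree D) m = δ
    · rw [← coeff_dehomogenize D hhom' hm, ← coeff_dehomogenize D hhom hm,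
        dehomogenize_homogenize, dehomogenize_homogenize, coeff_initialForm]
      congr 1
      rw [eq_iff_iff]
      constructor
      · intro h m' hm'
        rw [weight_tropSection, weight_tropSection]
        refine h _ ?_
        rw [mem_support_iff]
        nth_rewrite 1 [← dehomogenize_homogenize D δ p]
        rw [coeff_dehomogenize D hhom (hhom (mem_support_iff.1 hm'))]
        exact mem_support_iff.1 hm'
      · intro h α hα
        rw [← dehomogenize_homogenize D δ p] at hα
        obtain ⟨m', hm', rfl⟩ := exists_mem_support_of_dehomogenize hα
        rw [← weight_tropSection (n := n), ← weight_tropSection (n := n)]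
        exact h m' hm'
    · rw [hhom'.coeff_eq_zero m hm, hhom.coeff_eq_zero m hm, ite_self]

end Rees

/-! ### Saturation of the extended Rees algebra -/

section Saturation

open MvPolynomial

variable {k A : Type*} [Field k] [CommRing A] [Algebra k A] {n d : ℕ} (D : Fin n → Fin d → ℤ)
  (V : Fin n → AddValuation A (WithTop ℤ)) (b : Fin d → A)

/-- The image of the presentation map is the full ring `⨁_r {f | V_i f ≥ r_i for all i} t^r`. -/
def IsReesSaturated (k : Type*) {A : Type*} [Field k] [CommRing A] [Algebra k A] {n d : ℕ}
    (D : Fin n → Fin d → ℤ) (V : Fin n → AddValuation A (WithTop ℤ)) (b : Fin d → A) : Prop :=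
  ∀ (r : Fin n → ℤ) (f : A), (∀ i, (r i : WithTop ℤ) ≤ V i f) →
    AddMonoidAlgebra.single r f ∈ (reesHom D k b).range

variable {D V b}

theorem WithTop.intCast_add_one_le {z : ℤ} {x : WithTop ℤ} (h : (z : WithTop ℤ) < x) :
    ((z + 1 : ℤ) : WithTop ℤ) ≤ x := by
  induction x using WithTop.recTopCoe with
  | top => exact le_top
  | coe y =>
    have h' : z < y := by exact_mod_cast h
    exact_mod_cast h'

theorem exists_isWeightedHomogeneous_of_single_mem_range {r : Fin n → ℤ} {f : A}
    (h : AddMonoidAlgebra.single r f ∈ (reesHom D k b).range) :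
    ∃ P : MvPolynomial (Fin d ⊕ Fin n) k, IsWeightedHomogeneous (columnDegree D) P r ∧
      reesHom D k b P = AddMonoidAlgebra.single r f := by
  obtain ⟨P, hP⟩ := h
  have hP' : reesHom D k b P = AddMonoidAlgebra.single r f := hP
  refine ⟨_, weightedHomogeneousComponent_isWeightedHomogeneous r P, ?_⟩
  rw [reesHom_of_isWeightedHomogeneous D b
    (weightedHomogeneousComponent_isWeightedHomogeneous r P), ← reesHom_apply, hP']
  simp

/-- In a fixed multidegree, the terms of least possible weight are those without `X_i`. -/
theorem weight_tropSection_intCast (i : Fin n) (m : Fin d ⊕ Fin n →₀ ℕ) :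
    Finsupp.weight (tropSection n fun j => (D i j : ℚ)) m =
      ((Finsupp.weight (columnDegree D) m i + m (Sum.inr i) : ℤ) : ℚ) := by
  rw [weight_tropSection, weight_intCast, weight_columnDegree]
  simp

variable (hV : ∀ i, ∀ c : k, c ≠ 0 → V i (algebraMap k A c) = 0)
  (hD : ∀ i j, V i (b j) = D i j) (hs : ∀ i, HasSubduction k (V i) b (D i))

include hV hD hs in
-- The part `p` of weight `z` has value above `z`, so saturation represents it in a multidegree
-- raised along `e_i`, by some `Q`. Then `X_i^q Q` represents the same element as the homogenization
-- of `p`, with all weights above `z`.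
theorem mem_initialIdeal_of_isReesSaturated (hsat : IsReesSaturated k D V b) (i : Fin n)
    {δ : Fin n → ℤ} {P : MvPolynomial (Fin d ⊕ Fin n) k}
    (hP : IsWeightedHomogeneous (columnDegree D) P δ)
    (hmem : dehomogenize k n d P ∈
      initialIdeal (fun j => (D i j : ℚ)) (presentationIdeal k b)) :
    P ∈ initialIdeal (tropSection n fun j => (D i j : ℚ)) (RingHom.ker (reesHom D k b)) := by
  classical
  rw [mem_initialIdeal_iff]
  intro ω
  by_cases hω : ∃ z : ℤ, (z : ℚ) = ω
  swap
  · refine ⟨0, Ideal.zero_mem _, fun m => ⟨fun _ => coeff_zero _, fun hm => ?_⟩⟩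
    exact absurd ⟨_, (weight_tropSection_intCast i m).symm.trans hm⟩ hω
  obtain ⟨z, rfl⟩ := hω
  set p := weightedHomogeneousComponent (D i) z (dehomogenize k n d P) with hp
  have hz : (z : WithTop ℤ) < V i (aeval b p) :=
    (mem_initialIdeal_ker_aeval_iff (hV i) (hD i) (hs i)).1 hmem z
  have hsupp : ∀ α ∈ p.support, ∀ l, δ l ≤ Finsupp.weight (D l) α := by
    intro α hα l
    have hα' : α ∈ (dehomogenize k n d P).support := by
      rw [mem_support_iff, hp, coeff_weightedHomogeneousComponent] at hα
      rw [mem_support_iff]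
      intro h0
      simp [h0] at hα
    obtain ⟨m, hm, rfl⟩ := exists_mem_support_of_dehomogenize hα'
    have h := congrFun (hP (mem_support_iff.1 hm)) l
    rw [weight_columnDegree] at h
    omega
  have hH := isWeightedHomogeneous_homogenize D hsupp
  have hHφ := reesHom_homogenize D (k := k) b hsupp
  -- The least shift that brings the `i`-th degree up to `z + 1`; it is zero if that is already
  -- reached.
  set q := (z + 1 - δ i).toNat with hq
  set r : Fin n → ℤ := δ + Pi.single i (q : ℤ) with hr
  have hri : z + 1 ≤ r i := by
    rw [hr, Pi.add_apply, Pi.single_eq_same, hq]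
    omega
  obtain ⟨Q, hQ, hQφ⟩ := exists_isWeightedHomogeneous_of_single_mem_range
    (hsat r (aeval b p) fun l => by
      have hle : (δ l : WithTop ℤ) ≤ V l (aeval b p) :=
        le_map_aeval (hV l) (hD l) fun α hα => by exact_mod_cast hsupp α hα l
      by_cases hl : l = i
      · subst hl
        have h1 : r l ≤ δ l ∨ r l ≤ z + 1 := by
          rw [hr, Pi.add_apply, Pi.single_eq_same, hq]
          omega
        rcases h1 with h1 | h1
        · exact le_trans (by exact_mod_cast h1) hle
        · refine le_trans (b := ((z + 1 : ℤ) : WithTop ℤ)) (by exact_mod_cast h1) ?_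
          exact WithTop.intCast_add_one_le hz
      · rw [hr, Pi.add_apply, Pi.single_eq_of_ne hl, add_zero]
        exact hle)
  set e : Fin d ⊕ Fin n →₀ ℕ := Finsupp.single (Sum.inr i) q with he
  have hye : yPart e = 0 := yPart_single_inr i q
  have hde : Finsupp.weight (columnDegree D) e = -Pi.single i (q : ℤ) := by
    rw [he, Finsupp.weight_single]
    ext l
    by_cases hl : l = i
    · subst hl; simp [columnDegree]
    · simp [columnDegree, Pi.single_eq_of_ne hl]
  have hvan : ∀ m, Finsupp.weight (tropSection n fun j => (D i j : ℚ)) m ≤ z →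
      (monomial e (1 : k) * Q).coeff m = 0 := by
    intro m hm
    rw [coeff_monomial_mul']
    split_ifs with hle
    · rw [one_mul]
      by_contra hc
      have h1 := hQ hc
      rw [← tsub_add_cancel_of_le hle, weight_tropSection, map_add, hye, add_zero,
        ← weight_tropSection (n := n), weight_tropSection_intCast, h1] at hm
      have : r i + ((m - e) (Sum.inr i) : ℕ) ≤ z := by exact_mod_cast hm
      omega
    · rfl
  refine ⟨homogenize D δ p - monomial e 1 * Q, ?_, fun m => ?_⟩
  · rw [RingHom.mem_ker, map_sub, map_mul, hHφ, hQφ, reesHom_monomial, hde,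
      dehomogenize_monomial, hye, AddMonoidAlgebra.single_mul_single, hr]
    simp
  · have hpc : (homogenize D δ p).coeff m =
        if Finsupp.weight (tropSection n fun j => (D i j : ℚ)) m = z then P.coeff m else 0 := by
      by_cases hm : Finsupp.weight (columnDegree D) m = δ
      · rw [← coeff_dehomogenize D hH hm, dehomogenize_homogenize, hp,
          coeff_weightedHomogeneousComponent, coeff_dehomogenize D hP hm, weight_tropSection,
          weight_intCast]
        simp only [Int.cast_inj]
      · rw [hH.coeff_eq_zero m hm, hP.coeff_eq_zero m hm, ite_self]
    constructor
    · intro hm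
      rw [coeff_sub, hvan m hm.le, hpc, if_neg hm.ne, sub_zero]
    · intro hm
      rw [coeff_sub, hvan m hm.le, hpc, if_pos hm, sub_zero]

include hV hD hs in
-- The initial ideal is the kernel of the Rees map built from the classes of the `y_j` in the domain
-- `k[y]/I`, where `I` is the initial ideal downstairs.
theorem isPrime_initialIdeal_of_isReesSaturated (hsat : IsReesSaturated k D V b) (i : Fin n) :
    (initialIdeal (tropSection n fun j => (D i j : ℚ))
      (RingHom.ker (reesHom D k b))).IsPrime := by
  set I := initialIdeal (fun j => (D i j : ℚ)) (presentationIdeal k b) with hI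
  have hprime : I.IsPrime := isPrime_initialIdeal_ker_aeval (hV i) (hD i) (hs i)
  have hmk : ∀ q : MvPolynomial (Fin d) k,
      aeval (fun j => Ideal.Quotient.mk I (X j)) q = Ideal.Quotient.mk I q := fun q => by
    have h : aeval (fun j => Ideal.Quotient.mk I (X j)) = Ideal.Quotient.mkₐ k I := by
      ext j
      simp
    rw [h, Ideal.Quotient.mkₐ_eq_mk]
  have hker : initialIdeal (tropSection n fun j => (D i j : ℚ)) (RingHom.ker (reesHom D k b)) =
      RingHom.ker (reesHom D k fun j => Ideal.Quotient.mk I (X j)) := by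
    ext P
    constructor
    · intro hP
      rw [RingHom.mem_ker]
      ext δ
      rw [reesHom_apply, hmk, AddMonoidAlgebra.coeff_zero, Finsupp.zero_apply,
        Ideal.Quotient.eq_zero_iff_mem]
      exact dehomogenize_mem_initialIdeal D b hP δ
    · intro hP
      refine mem_of_weightedHomogeneousComponent_mem (columnDegree D) fun δ => ?_
      refine mem_initialIdeal_of_isReesSaturated hV hD hs hsat i
        (weightedHomogeneousComponent_isWeightedHomogeneous δ P) ?_
      rw [← hI, ← Ideal.Quotient.eq_zero_iff_mem, ← hmk, ← reesHom_apply,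
        (RingHom.mem_ker.1 hP : reesHom D k _ P = 0)]
      rfl
  rw [hker]
  exact RingHom.ker_isPrime _

include hV hD hs in
-- Subduction represents `f` by terms of `D_i`-weight above `r i`. Comparison with `P`, after
-- multiplication by a monomial `X^e`, puts `X^e` times the `X_i`-free part of `P` in the initial
-- ideal. Primeness removes `X^e`, so an element of the kernel corrects `P` to a multiple of `X_i`.
theorem single_add_mem_range_of_isPrime {i : Fin n}
    (hprime : (initialIdeal (tropSection n fun j => (D i j : ℚ))
      (RingHom.ker (reesHom D k b))).IsPrime) {r : Fin n → ℤ} {f : A}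
    (hf : AddMonoidAlgebra.single r f ∈ (reesHom D k b).range)
    (hfr : ((r i + 1 : ℤ) : WithTop ℤ) ≤ V i f) :
    AddMonoidAlgebra.single (r + Pi.single i 1) f ∈ (reesHom D k b).range := by
  classical
  set u := tropSection n fun j => (D i j : ℚ) with hu
  obtain ⟨P, hP, hPφ⟩ := exists_isWeightedHomogeneous_of_single_mem_range hf
  obtain ⟨p, hpf, hpw⟩ := hs i f
  have hpw' : ∀ α ∈ p.support, r i + 1 ≤ Finsupp.weight (D i) α := fun α hα => by
    exact_mod_cast hfr.trans (hpw α hα)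
  obtain ⟨δ, hδr, hδ⟩ := exists_le_weight D p.support r
  -- A common multidegree in which both `X^e P` and the homogenization of `p` represent `f`.
  set r' := Function.update δ i (r i) with hr'
  have hr'r : ∀ l, r' l ≤ r l := fun l => by
    by_cases hl : l = i
    · subst hl; simp [hr']
    · rw [hr', Function.update_of_ne hl]; exact hδr l
  have hvalid : ∀ α ∈ p.support, ∀ l, r' l ≤ Finsupp.weight (D l) α := fun α hα l => by
    by_cases hl : l = i
    · subst hl
      have := hpw' α hα
      rw [hr', Function.update_self]
      omega
    · rw [hr', Function.update_of_ne hl]; exact hδ α hα l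
  set e : Fin d ⊕ Fin n →₀ ℕ := Finsupp.sumElim 0 (Finsupp.equivFunOnFinite.symm
    fun l => (r l - r' l).toNat) with he
  have hye : yPart e = 0 := yPart_sumElim _ _
  have hde : Finsupp.weight (columnDegree D) e = r' - r := by
    ext l
    rw [weight_columnDegree, hye, he, Finsupp.sumElim_inr]
    have h2 := hr'r l
    simp only [Finsupp.equivFunOnFinite_symm_apply_apply, map_zero, Pi.sub_apply]
    omega
  have hH := isWeightedHomogeneous_homogenize D hvalid
  have hHφ := reesHom_homogenize D (k := k) b hvalid
  have hJ : monomial e (1 : k) * P - homogenize D r' p ∈ RingHom.ker (reesHom D k b) := by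
    rw [RingHom.mem_ker, map_sub, map_mul, hHφ, hPφ, reesHom_monomial, hde,
      dehomogenize_monomial, hye, AddMonoidAlgebra.single_mul_single, hpf]
    simp
  have hwP : ∀ m, P.coeff m ≠ 0 → Finsupp.weight u m = (r i + (m (Sum.inr i) : ℕ) : ℤ) :=
    fun m hm => by rw [hu, weight_tropSection_intCast, hP hm]
  have hwe : ∀ m, e ≤ m → Finsupp.weight u (m - e) = Finsupp.weight u m := fun m hm => by
    conv_rhs => rw [← tsub_add_cancel_of_le hm, hu, weight_tropSection, map_add, hye, add_zero]
    rw [hu, weight_tropSection]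
  have hHvan : ∀ m, Finsupp.weight u m ≤ r i → (homogenize D r' p).coeff m = 0 := by
    intro m hm
    by_contra hc
    have h1 : yPart m ∈ p.support := by
      rw [mem_support_iff]
      nth_rewrite 1 [← dehomogenize_homogenize D r' p]
      rwa [coeff_dehomogenize D hH (hH hc)]
    rw [hu, weight_tropSection, weight_intCast] at hm
    have h2 : Finsupp.weight (D i) (yPart m) ≤ r i := by exact_mod_cast hm
    have := hpw' _ h1
    omega
  -- The homogenization of `p` has only weights above `r i`, so the part of weight `r i` of the
  -- difference comes from `X^e P` alone.
  have hprod : monomial e (1 : k) * weightedHomogeneousComponent u (r i : ℚ) P ∈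
      initialIdeal u (RingHom.ker (reesHom D k b)) := by
    convert weightedHomogeneousComponent_mem_initialIdeal u hJ (ω := (r i : ℚ)) ?_ using 1
    · ext m
      rw [coeff_monomial_mul', coeff_weightedHomogeneousComponent,
        coeff_weightedHomogeneousComponent, coeff_sub, coeff_monomial_mul']
      by_cases hm : Finsupp.weight u m = r i
      · rw [if_pos hm, hHvan m hm.le, sub_zero]
        split_ifs with h1 h2
        · rfl
        · exact absurd ((hwe m h1).trans hm) h2
        · rfl
      · rw [if_neg hm]
        split_ifs with h1 h2
        · exact absurd ((hwe m h1).symm.trans h2) hm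
        · rw [mul_zero]
        · rfl
    · intro m hm
      rw [coeff_sub, hHvan m hm.le, sub_zero, coeff_monomial_mul']
      split_ifs with h1
      · rw [one_mul]
        by_contra hc
        have h2 := hwP _ hc
        rw [hwe m h1] at h2
        rw [h2] at hm
        have : r i + ((m - e) (Sum.inr i) : ℕ) < r i := by exact_mod_cast hm
        omega
      · rfl
  -- Setting `X = 1` would put `1` in the initial ideal downstairs, which is proper.
  have hmon : monomial e (1 : k) ∉ initialIdeal u (RingHom.ker (reesHom D k b)) := by
    intro h
    have h1 := dehomogenize_mem_initialIdeal D b h (Finsupp.weight (columnDegree D) e)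
    rw [(isWeightedHomogeneous_monomial (columnDegree D) e (1 : k)
      rfl).weightedHomogeneousComponent_same, dehomogenize_monomial, hye] at h1
    exact (isPrime_initialIdeal_ker_aeval (hV i) (hD i) (hs i)).ne_top
      ((Ideal.eq_top_iff_one _).2 h1)
  obtain ⟨Q, hQ, hQc⟩ := mem_initialIdeal_iff.1
    ((hprime.mem_or_mem hprod).resolve_left hmon) (r i : ℚ)
  set R := P - weightedHomogeneousComponent (columnDegree D) r Q with hR
  have hRφ : reesHom D k b R = AddMonoidAlgebra.single r f := by
    rw [hR, map_sub, hPφ,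
      (RingHom.mem_ker.1 (homogeneousComponent_mem_ker_reesHom D b hQ r) : reesHom D k b _ = 0),
      sub_zero]
  -- The `X_i`-free terms in multidegree `r` have weight exactly `r i`, where `P` and `Q` agree.
  have hRi : modMonomial R (Finsupp.single (Sum.inr i) 1) = 0 := by
    ext m
    by_cases hm : Finsupp.single (Sum.inr i) 1 ≤ m
    · rw [coeff_modMonomial_of_le _ hm, coeff_zero]
    · rw [coeff_modMonomial_of_not_le _ hm, coeff_zero, hR, coeff_sub,
        coeff_weightedHomogeneousComponent]
      have hm0 : m (Sum.inr i) = 0 := by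
        rw [Finsupp.single_le_iff] at hm
        omega
      split_ifs with hd
      · have hw : Finsupp.weight u m = r i := by
          rw [hu, weight_tropSection_intCast, hd, hm0]
          simp
        rw [(hQc m).2 hw, coeff_weightedHomogeneousComponent, if_pos hw, sub_self]
      · rw [hP.coeff_eq_zero m hd, sub_zero]
  have hdiv := divMonomial_add_modMonomial R (Finsupp.single (Sum.inr i) 1)
  rw [hRi, add_zero] at hdiv
  refine ⟨divMonomial R (Finsupp.single (Sum.inr i) 1), ?_⟩
  change reesHom D k b _ = _
  have hX : reesHom D k b (monomial (Finsupp.single (Sum.inr i) 1) 1) =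
      AddMonoidAlgebra.single (-Pi.single i 1) 1 := by
    rw [reesHom_monomial, dehomogenize_monomial, yPart_single_inr, Finsupp.weight_single]
    simp [columnDegree]
  have h1 : AddMonoidAlgebra.single (-Pi.single i 1) 1 * reesHom D k b
      (divMonomial R (Finsupp.single (Sum.inr i) 1)) = AddMonoidAlgebra.single r f := by
    rw [← hX, ← map_mul, hdiv, hRφ]
  have h2 := congrArg (AddMonoidAlgebra.single (Pi.single i 1) (1 : A) * ·) h1
  rwa [← mul_assoc, AddMonoidAlgebra.single_mul_single, AddMonoidAlgebra.single_mul_single,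
    add_neg_cancel, one_mul, one_mul, ← AddMonoidAlgebra.one_def, one_mul, add_comm] at h2

include hV hD hs in
-- Any polynomial expression for `f` homogenizes in a sufficiently low multidegree `δ ≤ r`; unit
-- steps then raise `δ` to `r`, the induction running on the total gap.
theorem isReesSaturated_of_isPrime
    (hsurj : Function.Surjective (aeval b : MvPolynomial (Fin d) k → A))
    (hprime : ∀ i, (initialIdeal (tropSection n fun j => (D i j : ℚ))
      (RingHom.ker (reesHom D k b))).IsPrime) : IsReesSaturated k D V b := by
  intro r f hf
  have key : ∀ N : ℕ, ∀ δ : Fin n → ℤ, δ ≤ r → ∑ i, (r i - δ i).toNat = N →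
      AddMonoidAlgebra.single δ f ∈ (reesHom D k b).range →
      AddMonoidAlgebra.single r f ∈ (reesHom D k b).range := by
    intro N
    induction N with
    | zero =>
      intro δ hδ hN hmem
      have : δ = r := by
        ext i
        have h1 := Finset.sum_eq_zero_iff.1 hN i (Finset.mem_univ i)
        have h2 : δ i ≤ r i := hδ i
        omega
      rwa [← this]
    | succ N ih =>
      intro δ hδ hN hmem
      obtain ⟨i, -, hi⟩ := Finset.exists_ne_zero_of_sum_ne_zero (by rw [hN]; omega :
        ∑ i, (r i - δ i).toNat ≠ 0)
      have hlt : δ i + 1 ≤ r i := by omega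
      refine ih (δ + Pi.single i 1) (fun l => ?_) ?_
        (single_add_mem_range_of_isPrime hV hD hs (hprime i) hmem
          (le_trans (by exact_mod_cast hlt) (hf i)))
      · by_cases hl : l = i
        · subst hl; simpa using hlt
        · simpa [Pi.single_eq_of_ne hl] using hδ l
      · have h1 : ∀ g : Fin n → ℕ, ∑ l, g l = g i + ∑ l ∈ Finset.univ.erase i, g l :=
          fun g => (Finset.add_sum_erase _ g (Finset.mem_univ i)).symm
        rw [h1] at hN ⊢
        have h2 : ∑ l ∈ Finset.univ.erase i, (r l - (δ + Pi.single i 1 : Fin n → ℤ) l).toNat =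
            ∑ l ∈ Finset.univ.erase i, (r l - δ l).toNat :=
          Finset.sum_congr rfl fun l hl => by
            rw [Pi.add_apply, Pi.single_eq_of_ne (Finset.ne_of_mem_erase hl), add_zero]
        rw [h2, Pi.add_apply, Pi.single_eq_same]
        omega
  obtain ⟨p, rfl⟩ := hsurj f
  obtain ⟨δ, hδ, hw⟩ := exists_le_weight D p.support r
  exact key _ δ hδ rfl ⟨_, reesHom_homogenize D b hw⟩

end Saturation

/-! ### Divisors on a smooth fan -/

namespace RationalFan

variable {N : Type*} [AddCommGroup N] {S : RationalFan N}

/-- The form that is `0` on `e t` and `1` on the other basis vectors cuts out the face `ℕ e t`. -/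
theorem basis_mem_rays {ι : Type*} [DecidableEq ι] {σ : AddSubmonoid N} (hσ : σ ∈ S.cones)
    (e : Module.Basis ι ℤ N) {T : Set ι} (hT : σ = AddSubmonoid.closure (e '' T)) {t : ι}
    (ht : t ∈ T) : e t ∈ S.rays := by
  refine ⟨e.ne_zero t, S.face_mem σ hσ _ ?_⟩
  set m : N →ₗ[ℤ] ℤ := e.constr ℤ fun s => if s = t then 0 else 1 with hm
  have hme : ∀ s, m (e s) = if s = t then 0 else 1 := fun s => e.constr_basis ℤ _ s
  have key : ∀ x ∈ σ, 0 ≤ m x ∧ (m x = 0 → x ∈ AddSubmonoid.multiples (e t)) := by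
    intro x hx
    rw [hT] at hx
    induction hx using AddSubmonoid.closure_induction with
    | mem x hx =>
      obtain ⟨s, -, rfl⟩ := hx
      rw [hme]
      split_ifs with hs
      · exact ⟨le_rfl, fun _ => hs ▸ AddSubmonoid.mem_multiples _⟩
      · exact ⟨zero_le_one, fun h => absurd h one_ne_zero⟩
    | zero => exact ⟨by simp, fun _ => zero_mem _⟩
    | add x y _ _ hx hy =>
      rw [map_add]
      exact ⟨add_nonneg hx.1 hy.1, fun h => add_mem (hx.2 (by linarith [hx.1, hy.1]))
        (hy.2 (by linarith [hx.1, hy.1]))⟩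
  refine ⟨m.toAddMonoidHom, fun x hx => (key x hx).1,
    fun x => Iff.intro ?_ fun h => (key x h.1).2 h.2⟩
  rintro ⟨q, rfl⟩
  refine ⟨?_, ?_⟩
  · rw [hT]
    exact nsmul_mem (AddSubmonoid.subset_closure (Set.mem_image_of_mem e ht)) q
  · change m (q • e t) = 0
    rw [map_nsmul, hme, if_pos rfl, smul_zero]

/-- The ray meets `σ` in a face, cut out by a form `m` nonnegative on `σ`. As `m ρ = 0`, some
generator `e s` lies in that face, so `e s` is a multiple of `ρ`. -/
theorem ray_mem_basis {ι : Type*} {σ : AddSubmonoid N} (hσ : σ ∈ S.cones)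
    (e : Module.Basis ι ℤ N) {T : Set ι} (hT : σ = AddSubmonoid.closure (e '' T)) {ρ : N}
    (hρ : ρ ∈ S.rays) (hρσ : ρ ∈ σ) : ρ ∈ Set.range e := by
  obtain ⟨m, hm0, hm⟩ := S.inter_face σ hσ _ hρ.2
  have hmρ : m ρ = 0 := ((hm ρ).1 ⟨hρσ, AddSubmonoid.mem_multiples ρ⟩).2
  have key : ∀ x ∈ σ, 0 ≤ m x ∧ (m x = 0 → x ≠ 0 → ∃ s, e s ∈ σ ∧ m (e s) = 0) := by
    intro x hx
    refine ⟨hm0 x hx, ?_⟩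
    rw [hT] at hx
    induction hx using AddSubmonoid.closure_induction with
    | mem x hx =>
      obtain ⟨s, hs, rfl⟩ := hx
      exact fun h _ => ⟨s, hT ▸ AddSubmonoid.subset_closure ⟨s, hs, rfl⟩, h⟩
    | zero => exact fun _ h => absurd rfl h
    | add x y hx' hy' hx hy =>
      intro h hne
      rw [map_add] at h
      rw [← hT] at hx' hy'
      have h1 := hm0 x hx'
      have h2 := hm0 y hy'
      by_cases hx0 : x = 0
      · exact hy (by linarith) fun hy0 => hne (by rw [hx0, hy0, add_zero])
      · exact hx (by linarith) hx0
  obtain ⟨s, hs, hms⟩ := (key ρ hρσ).2 hmρ hρ.1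
  obtain ⟨q, hq⟩ := ((hm (e s)).2 ⟨hs, hms⟩).2
  have h1 := congrArg (fun x => e.repr x s) hq
  simp only [map_nsmul, Finsupp.smul_apply, e.repr_self, Finsupp.single_eq_same,
    nsmul_eq_mul] at h1
  -- The coordinate `s` of `q • ρ = e s` makes the natural number `q` a unit of `ℤ`.
  have hq1 : q = 1 := by
    have := Int.isUnit_iff.1 (IsUnit.of_mul_eq_one _ h1)
    omega
  exact ⟨s, by simpa [hq1] using hq.symm⟩

theorem mem_closure_rays (hS : S.IsSmooth) {σ : AddSubmonoid N} (hσ : σ ∈ S.cones) {x : N}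
    (hx : x ∈ σ) : x ∈ AddSubmonoid.closure {ρ | ρ ∈ S.rays ∧ ρ ∈ σ} := by
  obtain ⟨e, T, hT⟩ := hS σ hσ
  have hle : AddSubmonoid.closure (e '' T) ≤ AddSubmonoid.closure {ρ | ρ ∈ S.rays ∧ ρ ∈ σ} := by
    refine AddSubmonoid.closure_mono ?_
    rintro _ ⟨t, ht, rfl⟩
    exact ⟨basis_mem_rays hσ e hT ht, hT ▸ AddSubmonoid.subset_closure ⟨t, ht, rfl⟩⟩
  exact hle (hT ▸ hx)

theorem le_of_le_on_rays (hS : S.IsSmooth) {σ : AddSubmonoid N} (hσ : σ ∈ S.cones)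
    (m m' : N →+ ℤ) (h : ∀ ρ ∈ S.rays, ρ ∈ σ → m ρ ≤ m' ρ) {x : N} (hx : x ∈ σ) :
    m x ≤ m' x := by
  have hx' := mem_closure_rays hS hσ hx
  clear hx
  induction hx' using AddSubmonoid.closure_induction with
  | mem x hx => exact h x hx.1 hx.2
  | zero => simp
  | add x y _ _ hx hy => rw [map_add, map_add]; exact add_le_add hx hy

/-- On a smooth fan there is a piecewise linear function with given values on the rays. -/
theorem exists_divisor (hS : S.IsSmooth) (r : S.rays → ℤ) :
    ∃ ψ : S.divisors, ∀ ρ, ψ.1 (S.rayPoint ρ) = r ρ := by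
  classical
  have hm : ∀ σ ∈ S.cones, ∃ m : N →+ ℤ, ∀ ρ : S.rays, ρ.1 ∈ σ → m ρ.1 = r ρ := by
    intro σ hσ
    obtain ⟨e, T, hT⟩ := hS σ hσ
    refine ⟨(e.constr ℤ fun t => if h : e t ∈ S.rays then r ⟨e t, h⟩ else 0).toAddMonoidHom, ?_⟩
    rintro ⟨ρ, hρ⟩ hρσ
    obtain ⟨t, rfl⟩ := ray_mem_basis hσ e hT hρ hρσ
    change (e.constr ℤ fun t => if h : e t ∈ S.rays then r ⟨e t, h⟩ else 0) (e t) = _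
    rw [e.constr_basis, dif_pos hρ]
  choose! m hm using hm
  choose c hc hxc using fun x : S.support => x.2
  -- The local forms glue: two cones meet in a cone of the fan, which is generated by rays on which
  -- both forms take the prescribed values.
  have hagree : ∀ (x : S.support) (τ), τ ∈ S.cones → x.1 ∈ τ → m (c x) x.1 = m τ x.1 := by
    intro x τ hτ hx
    have hint : c x ⊓ τ ∈ S.cones := S.face_mem _ (hc x) _ (S.inter_face _ (hc x) _ hτ)
    have heq : ∀ ρ ∈ S.rays, ρ ∈ c x ⊓ τ → m (c x) ρ = m τ ρ := fun ρ hρ hρi =>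
      (hm _ (hc x) ⟨ρ, hρ⟩ hρi.1).trans (hm _ hτ ⟨ρ, hρ⟩ hρi.2).symm
    exact le_antisymm
      (le_of_le_on_rays hS hint _ _ (fun ρ h h' => (heq ρ h h').le) ⟨hxc x, hx⟩)
      (le_of_le_on_rays hS hint _ _ (fun ρ h h' => (heq ρ h h').ge) ⟨hxc x, hx⟩)
  refine ⟨⟨fun x => m (c x) x.1, fun τ hτ => ⟨m τ, fun x hx => hagree x τ hτ hx⟩⟩, fun ρ => ?_⟩
  exact hm _ (hc (S.rayPoint ρ)) ρ (hxc (S.rayPoint ρ))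

theorem divisor_ext (hS : S.IsSmooth) {ψ ψ' : S.divisors}
    (h : ∀ ρ, ψ.1 (S.rayPoint ρ) = ψ'.1 (S.rayPoint ρ)) : ψ = ψ' := by
  ext x
  obtain ⟨σ, hσ, hx⟩ := x.2
  obtain ⟨m, hm⟩ := ψ.2 σ hσ
  obtain ⟨m', hm'⟩ := ψ'.2 σ hσ
  have heq : ∀ ρ ∈ S.rays, ρ ∈ σ → m ρ = m' ρ := fun ρ hρ hρσ =>
    ((hm (S.rayPoint ⟨ρ, hρ⟩) hρσ).symm.trans (h ⟨ρ, hρ⟩)).trans (hm' (S.rayPoint ⟨ρ, hρ⟩) hρσ)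
  rw [hm x hx, hm' x hx]
  exact le_antisymm (le_of_le_on_rays hS hσ _ _ (fun ρ h h' => (heq ρ h h').le) hx)
    (le_of_le_on_rays hS hσ _ _ (fun ρ h h' => (heq ρ h h').ge) hx)

end RationalFan

/-! ### The total section ring as a ring of Laurent polynomials -/

section TotalSections

variable {k A N : Type*} [Field k] [CommRing A] [Algebra k A] [AddCommGroup N]
  {S : RationalFan N} {v : Quasivaluation k A S.support}

theorem value_ne_top (hvflat : ∀ σ ∈ S.cones, HasLinearAdaptedBasis v σ) (x : S.support)
    {f : A} (hf : f ≠ 0) : v f x ≠ ⊤ := by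
  obtain ⟨σ, hσ, hx⟩ := x.2
  obtain ⟨𝔹, e, -, hmin, hlin⟩ := hvflat σ hσ
  rw [hmin f x hx]
  have hne : (e.repr f).support.Nonempty := by
    rw [Finsupp.support_nonempty_iff]
    exact fun h => hf (e.repr.map_eq_zero_iff.1 h)
  obtain ⟨c, -, hc⟩ := Finset.exists_mem_eq_inf _ hne fun b => v b.1 x
  obtain ⟨m, hm⟩ := hlin c
  rw [hc, hm x hx]
  exact WithTop.coe_ne_top

/-- On a smooth fan the section spaces are cut out by the conditions on the rays. -/
theorem mem_sectionSpace_iff (hS : S.IsSmooth)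
    (hvflat : ∀ σ ∈ S.cones, HasLinearAdaptedBasis v σ) {ψ : S.divisors} {f : A} :
    f ∈ sectionSpace v ψ ↔
      ∀ ρ, ((ψ.1 (S.rayPoint ρ) : ℤ) : WithTop ℤ) ≤ v f (S.rayPoint ρ) := by
  refine ⟨fun h ρ => h _, fun h x => ?_⟩
  obtain ⟨σ, hσ, hx⟩ := x.2
  obtain ⟨𝔹, e, -, hmin, hlin⟩ := hvflat σ hσ
  obtain ⟨m, hm⟩ := ψ.2 σ hσ
  rw [hmin f x hx]
  -- Adaptedness bounds each basis element occurring in `f` on the rays of `σ`; both sides are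
  -- linear on `σ`, so the bound spreads to the cone.
  refine Finset.le_inf fun c hc => ?_
  obtain ⟨m', hm'⟩ := hlin c
  rw [hm x hx, hm' x hx]
  refine WithTop.coe_le_coe.2 (RationalFan.le_of_le_on_rays hS hσ _ _ (fun ρ hρ hρσ => ?_) hx)
  have h1 := h ⟨ρ, hρ⟩
  rw [hmin f (S.rayPoint ⟨ρ, hρ⟩) hρσ, hm (S.rayPoint ⟨ρ, hρ⟩) hρσ] at h1
  have h2 := h1.trans (Finset.inf_le hc)
  rw [hm' (S.rayPoint ⟨ρ, hρ⟩) hρσ] at h2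
  exact WithTop.coe_le_coe.1 h2

variable {n d : ℕ} (ρ : Fin n ≃ S.rays)

/-- The values of a divisor on the rays. -/
def rayValues (ψ : S.divisors) : Fin n → ℤ := fun i => ψ.1 (S.rayPoint (ρ i))

theorem rayValues_injective (hS : S.IsSmooth) : Function.Injective (rayValues ρ) := by
  intro ψ ψ' h
  refine RationalFan.divisor_ext hS fun ρ' => ?_
  have := congrFun h (ρ.symm ρ')
  simpa [rayValues] using this

theorem exists_rayValues_eq (hS : S.IsSmooth) (r : Fin n → ℤ) :
    ∃ ψ : S.divisors, rayValues ρ ψ = r := by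
  obtain ⟨ψ, hψ⟩ := RationalFan.exists_divisor hS fun ρ' => r (ρ.symm ρ')
  exact ⟨ψ, funext fun i => by simp [rayValues, hψ]⟩

open Classical in
/-- The embedding of the total section ring into the Laurent polynomials over `A`. -/
noncomputable def laurentMap (v : Quasivaluation k A S.support) :
    TotalSectionRing v →ₐ[k] AddMonoidAlgebra A (Fin n → ℤ) :=
  DirectSum.toAlgebra k (fun ψ => sectionSpace v ψ)
    (fun ψ =>
      { toFun := fun a => AddMonoidAlgebra.single (rayValues ρ ψ) (a : A)
        map_add' := fun a a' => by simp [AddMonoidAlgebra.single_add]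
        map_smul' := fun c a => by simp [AddMonoidAlgebra.smul_single] })
    rfl
    (fun a a' => by
      change AddMonoidAlgebra.single _ _ = AddMonoidAlgebra.single _ _ * AddMonoidAlgebra.single _ _
      rw [AddMonoidAlgebra.single_mul_single]
      rfl)

open Classical in
theorem laurentMap_of (ψ : S.divisors) (a : sectionSpace v ψ) :
    laurentMap ρ v (DirectSum.of (fun ψ => sectionSpace v ψ) ψ a) =
      AddMonoidAlgebra.single (rayValues ρ ψ) (a : A) := by
  exact DirectSum.toAddMonoid_of
    (fun ψ => (AddMonoidHom.mk' (fun a : sectionSpace v ψ =>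
      AddMonoidAlgebra.single (rayValues ρ ψ) (a : A)) fun a a' => by
        simp [AddMonoidAlgebra.single_add])) ψ a

theorem coeff_laurentMap (hS : S.IsSmooth) (y : TotalSectionRing v) (ψ : S.divisors) :
    (laurentMap ρ v y).coeff (rayValues ρ ψ) = (y ψ : A) := by
  classical
  induction y using DirectSum.induction_on with
  | zero => simp
  | of φ a =>
    rw [laurentMap_of, AddMonoidAlgebra.coeff_single, Finsupp.single_apply]
    simp only [(rayValues_injective ρ hS).eq_iff]
    refine Eq.trans ?_ (DirectSum.coe_of_apply (A := fun ψ => sectionSpace v ψ) φ ψ a).symm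
    split_ifs <;> rfl
  | add y z hy hz =>
    rw [map_add, AddMonoidAlgebra.coeff_add, Finsupp.add_apply, hy, hz]
    rfl

theorem laurentMap_injective (hS : S.IsSmooth) : Function.Injective (laurentMap ρ v) := by
  intro y z h
  ext ψ
  rw [← coeff_laurentMap ρ hS, ← coeff_laurentMap ρ hS, h]

variable (b : Fin d → A)

theorem value_eq_diagram (hvflat : ∀ σ ∈ S.cones, HasLinearAdaptedBasis v σ)
    (hb0 : ∀ j, b j ≠ 0) (i : Fin n) (j : Fin d) :
    v (b j) (S.rayPoint (ρ i)) = (diagram v ρ b i j : ℤ) := by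
  obtain ⟨z, hz⟩ := WithTop.ne_top_iff_exists.1 (value_ne_top hvflat (S.rayPoint (ρ i)) (hb0 j))
  rw [diagram, Quasivaluation.intValue, ← hz]
  rfl

theorem single_one_mem_range (D : Fin n → Fin d → ℤ) {δ : Fin n → ℤ} (hδ : δ ≤ 0) :
    AddMonoidAlgebra.single δ 1 ∈ (reesHom D k b).range := by
  classical
  refine ⟨_, (reesHom_homogenize D b (δ := δ) (p := 1) fun α hα i => ?_).trans (by simp)⟩
  have h0 : α = 0 := by
    rw [MvPolynomial.mem_support_iff, MvPolynomial.coeff_one] at hα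
    by_contra h
    exact hα (if_neg (Ne.symm h))
  rw [h0, map_zero]
  exact hδ i

theorem single_generator_mem_range (D : Fin n → Fin d → ℤ) {δ : Fin n → ℤ} {j : Fin d}
    (hδ : ∀ i, δ i ≤ D i j) : AddMonoidAlgebra.single δ (b j) ∈ (reesHom D k b).range := by
  classical
  refine ⟨_, (reesHom_homogenize D b (δ := δ) (p := MvPolynomial.X j) fun α hα i => ?_).trans
    (by simp)⟩
  rw [MvPolynomial.support_X, Finset.mem_singleton] at hα
  rw [hα, Finsupp.weight_single, one_smul]
  exact hδ i

/-- Under `laurentMap` the Cox monomials become the monomials in the `t_i⁻¹`, and a homogeneous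
generator lying over `b j` becomes `b j` times `t` to the `j`-th column of `D`, up to such a
monomial. -/
theorem isStrongKhovanskiiBasis_iff (hS : S.IsSmooth) (hv : v.IsValuation)
    (hvflat : ∀ σ ∈ S.cones, HasLinearAdaptedBasis v σ) (hb0 : ∀ j, b j ≠ 0) :
    IsStrongKhovanskiiBasis v (Set.range b) ↔
      IsReesSaturated k (diagram v ρ b)
        (fun i => Quasivaluation.addValuationAt hv (S.rayPoint (ρ i))) b := by
  classical
  have hsec : ∀ (ψ : S.divisors) (f : A), f ∈ sectionSpace v ψ ↔
      ∀ i, ((rayValues ρ ψ i : ℤ) : WithTop ℤ) ≤ v f (S.rayPoint (ρ i)) := fun ψ f =>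
    (mem_sectionSpace_iff hS hvflat).trans ⟨fun h i => h _, fun h ρ' => by
      simpa [rayValues] using h (ρ.symm ρ')⟩
  have hval := value_eq_diagram (v := v) ρ b hvflat hb0
  constructor
  · rintro ⟨G, hG, htop, himage⟩ r f hf
    obtain ⟨ψ, rfl⟩ := exists_rayValues_eq ρ hS r
    have hfψ : f ∈ sectionSpace v ψ := (hsec ψ f).2 hf
    have hle : Algebra.adjoin k (coxMonomials v ∪ G) ≤
        (reesHom (diagram v ρ b) k b).range.comap (laurentMap ρ v) := by
      refine Algebra.adjoin_le ?_
      rintro g (⟨φ, h1, rfl⟩ | hg)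
      · rw [SetLike.mem_coe, Subalgebra.mem_comap, laurentMap_of]
        refine single_one_mem_range b _ fun i => ?_
        have := (hsec φ 1).1 h1 i
        rw [v.map_one_eq] at this
        exact_mod_cast this
      · obtain ⟨φ, ⟨a, ha⟩, rfl⟩ := hG g hg
        have hab : a ∈ Set.range b := by
          rw [← himage]
          exact ⟨_, hg, DirectSum.coeAlgHom_of _ _ _⟩
        obtain ⟨j, rfl⟩ := hab
        rw [SetLike.mem_coe, Subalgebra.mem_comap, laurentMap_of]
        refine single_generator_mem_range b _ fun i => ?_
        have := (hsec φ (b j)).1 ha i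
        rw [hval] at this
        exact_mod_cast this
    rw [htop] at hle
    have h := hle (show DirectSum.of (fun ψ => sectionSpace v ψ) ψ ⟨f, hfψ⟩ ∈ _ from trivial)
    rwa [Subalgebra.mem_comap, laurentMap_of] at h
  · intro hsat
    -- Each `b j` is placed in the largest degree that contains it.
    choose ψ hψ using fun j => exists_rayValues_eq ρ hS fun i => diagram v ρ b i j
    have hbψ : ∀ j, b j ∈ sectionSpace v (ψ j) := fun j => (hsec _ _).2 fun i => by
      rw [hψ, hval]
    refine ⟨Set.range fun j => DirectSum.of (fun ψ => sectionSpace v ψ) (ψ j) ⟨b j, hbψ j⟩,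
      ?_, ?_, ?_⟩
    · rintro _ ⟨j, rfl⟩
      exact ⟨_, _, rfl⟩
    · set 𝒢 := Set.range fun j => DirectSum.of (fun ψ => sectionSpace v ψ) (ψ j) ⟨b j, hbψ j⟩
      have hrange : (reesHom (diagram v ρ b) k b).range ≤
          (Algebra.adjoin k (coxMonomials v ∪ 𝒢)).map (laurentMap ρ v) := by
        rw [reesHom, ← Algebra.adjoin_range_eq_range_aeval]
        refine Algebra.adjoin_le ?_
        rintro _ ⟨j | i, rfl⟩
        · refine ⟨_, Algebra.subset_adjoin (Or.inr ⟨j, rfl⟩), ?_⟩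
          refine (laurentMap_of ρ _ _).trans ?_
          rw [hψ]
          rfl
        · obtain ⟨φ, hφ⟩ := exists_rayValues_eq ρ hS (-Pi.single i 1)
          have h1 : (1 : A) ∈ sectionSpace v φ := (hsec _ _).2 fun l => by
            rw [hφ, v.map_one_eq]
            have : (-Pi.single i 1 : Fin n → ℤ) l ≤ 0 := by
              by_cases hl : l = i
              · subst hl; simp
              · simp [Pi.single_eq_of_ne hl]
            exact_mod_cast this
          refine ⟨_, Algebra.subset_adjoin (Or.inl ⟨φ, h1, rfl⟩), ?_⟩
          refine (laurentMap_of ρ _ _).trans ?_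
          rw [hφ]
          rfl
      refine eq_top_iff.2 fun y _ => ?_
      have hy : laurentMap ρ v y ∈ (reesHom (diagram v ρ b) k b).range := by
        induction y using DirectSum.induction_on with
        | zero => rw [map_zero]; exact zero_mem _
        | of φ a =>
          rw [laurentMap_of]
          exact hsat _ _ ((hsec φ a).1 a.2)
        | add y z hy hz => rw [map_add]; exact add_mem (hy trivial) (hz trivial)
      obtain ⟨z, hz, hzy⟩ := hrange hy
      rwa [← laurentMap_injective ρ hS hzy]
    · rw [← Set.range_comp]
      congr 1
      ext j
      exact DirectSum.coeAlgHom_of _ _ _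

end TotalSections

/-! ### Faces -/

section Faces

variable {k A N : Type*} [Field k] [CommRing A] [Algebra k A] [AddCommGroup N]
  {S : RationalFan N} (v : Quasivaluation k A S.support) {n d : ℕ} (ρ : Fin n ≃ S.rays)
  (b : Fin d → A)

theorem mem_tropicalVariety_reesIdeal_iff {u : Fin d ⊕ Fin n → ℚ} :
    u ∈ tropicalVariety (reesIdeal v ρ b) ↔
      tropProj v ρ b u ∈ tropicalVariety (presentationIdeal k b) :=
  mem_tropicalVariety_ker_reesHom_iff (diagram v ρ b) b

theorem initialIdeal_tropSection_tropProj (u : Fin d ⊕ Fin n → ℚ) :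
    initialIdeal (tropSection n (tropProj v ρ b u)) (reesIdeal v ρ b) =
      initialIdeal u (reesIdeal v ρ b) :=
  initialIdeal_tropSection_reesProj (diagram v ρ b) b u

theorem tropProj_tropSection (w : Fin d → ℚ) : tropProj v ρ b (tropSection n w) = w :=
  reesProj_tropSection (diagram v ρ b) w

/-- The points of `Trop(I_B)` whose images under the section have the same initial ideal. -/
def faceThrough (w : Fin d → ℚ) : Set (Fin d → ℚ) :=
  {w' | w' ∈ tropicalVariety (presentationIdeal k b) ∧
    initialIdeal (tropSection n w') (reesIdeal v ρ b) =
      initialIdeal (tropSection n w) (reesIdeal v ρ b)}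

/-- Initial ideals are constant on the fibres of `π`, so faces upstairs are unions of fibres and
their images partition `Trop(I_B)`. -/
theorem mem_inducedFaces_and_mem_iff {w : Fin d → ℚ}
    (hw : w ∈ tropicalVariety (presentationIdeal k b)) {C : Set (Fin d → ℚ)} :
    C ∈ inducedFaces v ρ b ∧ w ∈ C ↔ C = faceThrough v ρ b w := by
  constructor
  · rintro ⟨⟨D, ⟨u₀, hu₀, rfl⟩, rfl⟩, ⟨u, ⟨hu, huu⟩, rfl⟩⟩
    ext w'
    constructor
    · rintro ⟨u', ⟨hu', huu'⟩, rfl⟩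
      refine ⟨(mem_tropicalVariety_reesIdeal_iff v ρ b).1 hu', ?_⟩
      rw [initialIdeal_tropSection_tropProj, initialIdeal_tropSection_tropProj, huu, huu']
    · rintro ⟨hw', h⟩
      refine ⟨tropSection n w', ⟨?_, ?_⟩, tropProj_tropSection v ρ b w'⟩
      · rwa [mem_tropicalVariety_reesIdeal_iff, tropProj_tropSection]
      · rw [h, initialIdeal_tropSection_tropProj, huu]
  · rintro rfl
    refine ⟨⟨_, ⟨tropSection n w, ?_, rfl⟩, ?_⟩, hw, rfl⟩
    · rwa [mem_tropicalVariety_reesIdeal_iff, tropProj_tropSection]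
    · ext w'
      constructor
      · rintro ⟨hw', h⟩
        refine ⟨tropSection n w', ⟨?_, h⟩, tropProj_tropSection v ρ b w'⟩
        rwa [mem_tropicalVariety_reesIdeal_iff, tropProj_tropSection]
      · rintro ⟨u, ⟨hu, h⟩, rfl⟩
        refine ⟨(mem_tropicalVariety_reesIdeal_iff v ρ b).1 hu, ?_⟩
        rw [initialIdeal_tropSection_tropProj, h]

theorem isPrimeCone_liftFace_faceThrough_iff {w : Fin d → ℚ}
    (hw : w ∈ tropicalVariety (presentationIdeal k b)) :
    IsPrimeCone (reesIdeal v ρ b) (liftFace v ρ b (faceThrough v ρ b w)) ↔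
      IsPrimePoint (reesIdeal v ρ b) (tropSection n w) := by
  have hsw : tropSection n w ∈ tropicalVariety (reesIdeal v ρ b) := by
    rwa [mem_tropicalVariety_reesIdeal_iff, tropProj_tropSection]
  have hlift : liftFace v ρ b (faceThrough v ρ b w) =
      {u | u ∈ tropicalVariety (reesIdeal v ρ b) ∧
        initialIdeal u (reesIdeal v ρ b) =
          initialIdeal (tropSection n w) (reesIdeal v ρ b)} := by
    ext u
    constructor
    · rintro ⟨hu, -, h⟩
      exact ⟨hu, by rw [← h, initialIdeal_tropSection_tropProj]⟩
    · rintro ⟨hu, h⟩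
      exact ⟨hu, (mem_tropicalVariety_reesIdeal_iff v ρ b).1 hu, by
        rw [initialIdeal_tropSection_tropProj, h]⟩
  rw [hlift]
  exact ⟨fun h => ⟨hsw, h.2 _ ⟨hsw, rfl⟩⟩,
    fun h => ⟨⟨_, hsw, rfl⟩, fun u hu => by rw [hu.2]; exact h.2⟩⟩

end Faces

/-! ### The main theorem -/

theorem mainTheorem5 {k A N : Type*} [Field k] [IsAlgClosed k] [CommRing A] [Algebra k A]
    [AddCommGroup N] [Module.Free ℤ N] [Module.Finite ℤ N]
    -- the positive grading of `A`
    (𝒜 : ℕ → Submodule k A) [GradedAlgebra 𝒜] (h𝒜 : ∀ m, Module.Finite k (𝒜 m))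
    -- the smooth fan and its rays
    (S : RationalFan N) (hS : S.IsSmooth) {n : ℕ} (ρ : Fin n ≃ S.rays)
    -- the valuation, which corresponds to a graded flat toric sheaf of algebras
    (v : Quasivaluation k A S.support) (hv : v.IsValuation)
    (hvPL : ∀ f, v f ∈ S.piecewiseLinear) (hvhom : v.IsHomogeneous 𝒜)
    (hvflat : ∀ σ ∈ S.cones, HasLinearAdaptedBasis v σ)
    -- the finite Khovanskii basis of homogeneous elements
    {d : ℕ} (b : Fin d → A) (hb0 : ∀ j, b j ≠ 0) (hbhom : ∀ j, ∃ m, b j ∈ 𝒜 m)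
    (hb : v.IsKhovanskiiBasis (Set.range b)) :
    -- each row of the diagram lies in exactly one face of `Trop(I_B)`, which is a prime cone
    (∀ i, ∃! C, C ∈ inducedFaces v ρ b ∧ diagramRow v ρ b i ∈ C) ∧
    (∀ i, ∀ C ∈ inducedFaces v ρ b, diagramRow v ρ b i ∈ C →
      C ⊆ tropicalVariety (presentationIdeal k b) ∧
      ∀ w ∈ C, initialIdeal w (presentationIdeal k b) =
          initialIdeal (diagramRow v ρ b i) (presentationIdeal k b) ∧
        (initialIdeal w (presentationIdeal k b)).IsPrime) ∧
    (IsStrongKhovanskiiBasis v (Set.range b) ↔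
      ∀ i, ∀ C ∈ inducedFaces v ρ b, diagramRow v ρ b i ∈ C →
        IsPrimeCone (reesIdeal v ρ b) (liftFace v ρ b C)) ∧
    (IsStrongKhovanskiiBasis v (Set.range b) ↔
      ∀ i, IsPrimePoint (reesIdeal v ρ b) (tropSection n (diagramRow v ρ b i))) := by
  have hV : ∀ i, ∀ c : k, c ≠ 0 →
      Quasivaluation.addValuationAt hv (S.rayPoint (ρ i)) (algebraMap k A c) = 0 :=
    fun i c hc => v.map_const c hc _
  have hD := value_eq_diagram (v := v) ρ b hvflat hb0
  have hs : ∀ i, HasSubduction k (Quasivaluation.addValuationAt hv (S.rayPoint (ρ i))) b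
      (diagram v ρ b i) := fun i =>
    Quasivaluation.hasSubduction_of_isKhovanskiiBasisAt 𝒜 h𝒜 hv hvhom
      (fun f hf => value_ne_top hvflat _ hf) hbhom (hD i) (hb.2 _)
  have htrop : ∀ i, diagramRow v ρ b i ∈ tropicalVariety (presentationIdeal k b) := fun i =>
    mem_tropicalVariety_ker_aeval (hV i) (hD i)
  have hprime : ∀ i, (initialIdeal (diagramRow v ρ b i) (presentationIdeal k b)).IsPrime :=
    fun i => isPrime_initialIdeal_ker_aeval (hV i) (hD i) (hs i)
  have hsurj : Function.Surjective (MvPolynomial.aeval b : MvPolynomial (Fin d) k → A) := by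
    intro f
    have h : f ∈ Algebra.adjoin k (Set.range b) := by rw [hb.1]; trivial
    rwa [Algebra.adjoin_range_eq_range_aeval] at h
  have hpoint : IsStrongKhovanskiiBasis v (Set.range b) ↔
      ∀ i, IsPrimePoint (reesIdeal v ρ b) (tropSection n (diagramRow v ρ b i)) := by
    rw [isStrongKhovanskiiBasis_iff ρ b hS hv hvflat hb0]
    constructor
    · intro hsat i
      refine ⟨?_, isPrime_initialIdeal_of_isReesSaturated hV hD hs hsat i⟩
      rw [mem_tropicalVariety_reesIdeal_iff, tropProj_tropSection]
      exact htrop i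
    · exact fun h => isReesSaturated_of_isPrime hV hD hs hsurj fun i => (h i).2
  refine ⟨fun i => ?_, fun i C hC hi => ?_, hpoint.trans (forall_congr' fun i => ?_), hpoint⟩
  · exact ⟨_, (mem_inducedFaces_and_mem_iff v ρ b (htrop i)).2 rfl,
      fun C hC => (mem_inducedFaces_and_mem_iff v ρ b (htrop i)).1 hC⟩
  · obtain rfl := (mem_inducedFaces_and_mem_iff v ρ b (htrop i)).1 ⟨hC, hi⟩
    refine ⟨fun w hw => hw.1, fun w hw => ?_⟩
    -- Points of one face share the initial ideal upstairs by definition; setting `X = 1` transfers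
    -- this to `I_B`.
    have heq : initialIdeal w (presentationIdeal k b) =
        initialIdeal (diagramRow v ρ b i) (presentationIdeal k b) := by
      rw [← map_dehomogenize_initialIdeal (diagram v ρ b) b w,
        ← map_dehomogenize_initialIdeal (diagram v ρ b) b]
      exact congrArg _ hw.2
    exact ⟨heq, by rw [heq]; exact hprime i⟩
  · rw [← isPrimeCone_liftFace_faceThrough_iff v ρ b (htrop i)]
    constructor
    · intro h C hC hi
      rwa [(mem_inducedFaces_and_mem_iff v ρ b (htrop i)).1 ⟨hC, hi⟩]
    · intro h
      have := (mem_inducedFaces_and_mem_iff v ρ b (htrop i)).2 rfl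
      exact h _ this.1 this.2
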